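/- **Setting.** A conformal field theory in the vertex operator formulation is a complex vector space $V=\bigoplus V_{(w_L,w_R)}$ graded by real weights with $2(w_L-w_R)\in\mathbb Z$ (integral spins in the bosonic case; half-integral spins occur in the NS–NS sector of a supersymmetric theory), with a vacuum, two commuting Virasoro algebras $L_n,\tilde L_n$ of equal central charge for which $V_{(w_L,w_R)}$ is the $(L_0,\tilde L_0)$-weight space, and single-valued vertex operators $$Y(u,z,\bar z)=\sum_{a,b}u_{a,b}\,z^{a-w_L}\bar z^{\,b-w_R}\qquad(u\in V_{(w_L,w_R)}),$$ where $u_{a,b}$ raises weights by $(a,b)$, satisfying commutativity and associativity (existence of four-point functions) and the $L_{-1}$, $\tilde L_{-1}$ derivative properties. Let $\hat V=\prod V_{(w_L,w_R)}$; all sums of vectors are taken in $\hat V$ and are required to converge unconditionally in each graded piece. For $r\in(0,1)$ let $A_r$ be the standard annulus $r\le|x|\le1$, so $U_{A_r}=r^{L_0+\tilde L_0}$. Let $(\Delta,\Theta)$ be one of the following, with $u\in V_{(\Delta,\Delta)}$: * ($N=0$) $\Delta=1$, $\Theta=\mathrm{id}$, $u$ primary; * ($N=1$) $\Delta=\tfrac12$,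 $\Theta=G_{-1/2}\tilde G_{-1/2}$, where $N=1$ supersymmetry of both chiralities is given and $u$ is superconformal primary; * ($N=2$, $cc$) $\Delta=\tfrac12$, $\Theta=G^-_{-1/2}\tilde G^-_{-1/2}$, where $N=2$ supersymmetry of both chiralities is given and $u$ is a $cc$ field (primary for both algebras, $G^+_{-1/2}u=\tilde G^+_{-1/2}u=0$). Put $v=\Theta u$, a field of weight $(1,1)$. Let $h\ge1$. A *deformation to order $h$ along $u$* consists of linear maps $U^k_{A_r}:V\to\hat V$ ($0\le k\le h$, $0<r<1$) and spinless elements $u^0=u,u^1,\dots,u^{h-1}\in\hat V$ such that, with $U_{A_r}(\epsilon)=\sum_kU^k_{A_r}\epsilon^k$ and $u(\epsilon)=\sum_ku^k\epsilon^k$: 1. $U^0_{A_r}=U_{A_r}$, and $U_{A_{rs}}(\epsilon)=U_{A_r}(\epsilon)U_{A_s}(\epsilon)$ modulo $\epsilon^{h+1}$; 2. $U_{A_r}(\epsilon)u(\epsilon)=r^{2\Delta}u(\epsilon)$ modulo $\epsilon^{h}$; 3. modulo $\epsilon^{h}$, $$\frac{dU_{A_r}(\epsilon)}{d\epsilon}=\lim_{\rho\to0}\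 \int_{x\in A_r}U_{A_{|x|}}(\epsilon)\circ\rho^{-2}\,Y\Big(\big(\tfrac{\rho}{|x|}\big)^{L_0+\tilde L_0}\Theta u(\epsilon),\tfrac{x}{|x|}\Big)\circ U_{A_{r/|x|}}(\epsilon)\,\frac{d^2x}{2\pi},$$ that is, the derivative is the integral over the annulus of the amplitude with the deforming field inserted at $x$ through a disk of radius $\rho$ shrinking to a point (the integral being evaluated separately for each choice of orders in $\epsilon$ and of intermediate weights, then summed). **Theorem.** Let such a deformation be given. Assume that $u^k$ has weight $>(\Delta,\Delta)$ for $1\le k<h$ (each nonzero component has $w_L>\Delta$ and $w_R>\Delta$), and that up to order $h$ the multiple mode series in (1) (applied to any element of $V$), and the multiple series obtained by formally applying the series (1) of order $l$ to the series (2) of order $k$ ($k+l\le h$), converge unconditionally. Then: (a) for every $r\in(0,1)$, on $V$, $$U^h_{A_r}=\sum_{m_1,\dots,m_h}\int_{s_h=r}^1s_h^{2m_h-1}\int_{s_{h-1}=r}^{s_h}s_{h-1}^{2m_{h-1}-1}\cdots\int_{s_1=r}^{s_2}s_1^{2m_1-1}\,v_{m_h,m_h}\cdots v_{m_1,m_1}\,ds_1\cdots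 ds_h\;U_{A_r}.\tag{1}$$ (b) A spinless $x\in\hat V$ is a possible $h$-th correction $u^h$ — that is, with $u^h=x$ the equation $U_{A_r}(\epsilon)u(\epsilon)=r^{2\Delta}u(\epsilon)$ holds modulo $\epsilon^{h+1}$ for all $r\in(0,1)$ — if and only if the obstruction $$\sum_{m_1+\cdots+m_h=0}\frac{1}{2^h(m_{h-1}+\cdots+m_1)\cdots m_1}\,v_{m_h,m_h}\cdots v_{m_1,m_1}u$$ vanishes and, up to a vector of weight $(\Delta,\Delta)$, $$x=\sum_{m_1+\cdots+m_h\ne0}\frac{1}{2^h(m_h+\cdots+m_1)(m_{h-1}+\cdots+m_1)\cdots m_1}\,v_{m_h,m_h}\cdots v_{m_1,m_1}u.\tag{2}$$ In both sums only the terms in which no factor of the displayed denominator vanishes occur. (c) An $h$-th correction $u^h$ exists if and only if the obstruction vanishes. -/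

import Mathlib

open Filter Topology MeasureTheory

noncomputable section

/-! Conventions. Weights are pairs `(w_L, w_R)` of real numbers. A mode is indexed by the
amount by which it raises the weight, so that for `u` of weight `κ` the vertex operator is
`Y(u, z, zbar) = ∑ a, u_a z^(a.1 - κ.1) zbar^(a.2 - κ.2)`. Convergence inside a graded piece
is convergence of all linear functionals; for a finite dimensional piece this is the usual
topology. -/

/-- The monomial `z^p.1 * (conj z)^p.2`; it is single valued in `z ≠ 0` when `p.1 - p.2` is
an integer. -/
def zpair (z : ℂ) (p : ℝ × ℝ) : ℂ :=
  Complex.exp (p.1 * Complex.log z + p.2 * (starRingEnd ℂ) (Complex.log z))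

/-- The family `f` of vectors is unconditionally summable with sum `x`, tested on all linear
functionals. -/
def WeakHasSum {ι V : Type*} [AddCommGroup V] [Module ℂ V] (f : ι → V) (x : V) : Prop :=
  ∀ φ : Module.Dual ℂ V, HasSum (fun i => φ (f i)) (φ x)

section Algebras

variable {V : Type*} [AddCommGroup V] [Module ℂ V]

/-- The operators `L n` satisfy the Virasoro relations with central charge `c`. -/
def IsVirasoro (c : ℂ) (L : ℤ → Module.End ℂ V) : Prop :=
  ∀ m n : ℤ, L m * L n - L n * L m =
    ((m : ℂ) - n) • L (m + n) + (if m + n = 0 then c / 12 * ((m : ℂ) ^ 3 - m) else 0) • 1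

/-- The operators `G k = G_{k + 1/2}` transform under `L` as the modes of a primary current
of weight `3/2`. -/
def IsSupercurrent (L G : ℤ → Module.End ℂ V) : Prop :=
  ∀ m k : ℤ, L m * G k - G k * L m = ((m : ℂ) / 2 - ((k : ℂ) + 1 / 2)) • G (m + k)

/-- The Neveu-Schwarz `N = 1` algebra, with `G k = G_{k + 1/2}`. -/
def IsNeveuSchwarz (c : ℂ) (L G : ℤ → Module.End ℂ V) : Prop :=
  IsVirasoro c L ∧ IsSupercurrent L G ∧
  ∀ j k : ℤ, G j * G k + G k * G j =
    (2 : ℂ) • L (j + k + 1) + (if j + k + 1 = 0 then c / 3 * ((j : ℂ) ^ 2 + j) else 0) • 1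

/-- The `N = 2` superconformal algebra (Neveu-Schwarz sector), with `Gp k = G^+_{k + 1/2}` and
`Gm k = G^-_{k + 1/2}`. -/
def IsN2Algebra (c : ℂ) (L J Gp Gm : ℤ → Module.End ℂ V) : Prop :=
  IsVirasoro c L ∧ IsSupercurrent L Gp ∧ IsSupercurrent L Gm ∧
  (∀ m n : ℤ, L m * J n - J n * L m = (-(n : ℂ)) • J (m + n)) ∧
  (∀ m n : ℤ, J m * J n - J n * J m = (if m + n = 0 then c / 3 * (m : ℂ) else 0) • 1) ∧
  (∀ m k : ℤ, J m * Gp k - Gp k * J m = Gp (m + k)) ∧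
  (∀ m k : ℤ, J m * Gm k - Gm k * J m = -Gm (m + k)) ∧
  (∀ j k : ℤ, Gp j * Gp k + Gp k * Gp j = 0) ∧
  (∀ j k : ℤ, Gm j * Gm k + Gm k * Gm j = 0) ∧
  ∀ j k : ℤ, Gp j * Gm k + Gm k * Gp j =
    (2 : ℂ) • L (j + k + 1) + ((j : ℂ) - k) • J (j + k + 1) +
      (if j + k + 1 = 0 then c / 3 * ((j : ℂ) ^ 2 + j) else 0) • 1

end Algebras

/-- A conformal field theory in the vertex operator formulation. Spins `w.1 - w.2` are allowed
to be half-integral, so that the Neveu-Schwarz sector of a supersymmetric theory is included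
(fields of half-integral spin are odd); a bosonic theory is one in which all spins are
integral. -/
structure ConformalFieldTheory (V : Type*) [AddCommGroup V] [Module ℂ V] where
  /-- the subspace of weight `w` -/
  gr : ℝ × ℝ → Submodule ℂ V
  isInternal : DirectSum.IsInternal gr
  spin : ∀ w, gr w ≠ ⊥ → ∃ n : ℤ, 2 * (w.1 - w.2) = n
  /-- the modes `u_a` of the vertex operator of `u` -/
  mode : V →ₗ[ℂ] (ℝ × ℝ → Module.End ℂ V)
  mode_mem : ∀ (u : V) (a w : ℝ × ℝ), ∀ v ∈ gr w, mode u a v ∈ gr (w + a)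
  mode_single_valued : ∀ κ, ∀ u ∈ gr κ, ∀ a, mode u a ≠ 0 →
    ∃ n : ℤ, (a.1 - κ.1) - (a.2 - κ.2) = n
  mode_discrete : ∀ κ, ∀ u ∈ gr κ, ∀ μ, ∀ v ∈ gr μ, DiscreteTopology {a | mode u a v ≠ 0}
  /-- the four point function: commutativity and associativity of the vertex operators -/
  four_point : ∀ κ, ∀ u ∈ gr κ, ∀ l, ∀ v ∈ gr l, ∀ μ, ∀ w ∈ gr μ, ∀ (ν : ℝ × ℝ)
    (φ : Module.Dual ℂ V) (n k : ℤ), 2 * (κ.1 - κ.2) = n → 2 * (l.1 - l.2) = k →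
    ∃ Z : ℂ × ℂ → ℂ,
      AnalyticOnNhd ℝ Z {p | p.1 ≠ 0 ∧ p.2 ≠ 0 ∧ p.1 ≠ p.2} ∧
      (∀ z t : ℂ, 0 < ‖t‖ → ‖t‖ < ‖z‖ →
        HasSum (fun β : ℝ × ℝ => zpair z (ν - β - κ) * zpair t (β - μ - l) *
          φ (mode u (ν - β) (mode v (β - μ) w))) (Z (z, t))) ∧
      (∀ z t : ℂ, 0 < ‖z‖ → ‖z‖ < ‖t‖ →
        HasSum (fun β : ℝ × ℝ => (-1 : ℂ) ^ (n * k) *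
          (zpair t (ν - β - l) * zpair z (β - μ - κ) *
            φ (mode v (ν - β) (mode u (β - μ) w)))) (Z (z, t))) ∧
      (∀ z t : ℂ, 0 < ‖z - t‖ → ‖z - t‖ < ‖t‖ →
        HasSum (fun β : ℝ × ℝ => zpair (z - t) (β - l - κ) * zpair t (ν - μ - β) *
          φ (mode (mode u (β - l) v) (ν - μ) w)) (Z (z, t)))
  /-- the vacuum -/
  vac : V
  vac_mem : vac ∈ gr 0
  mode_vac_zero : mode vac 0 = 1
  mode_vac : ∀ a, a ≠ 0 → mode vac a = 0
  creation : ∀ κ, ∀ u ∈ gr κ, mode u κ vac = u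
  creation_regular : ∀ κ, ∀ u ∈ gr κ, ∀ a, mode u a vac ≠ 0 →
    ∃ p q : ℕ, a = (κ.1 + p, κ.2 + q)
  /-- the common central charge -/
  c : ℂ
  /-- the left moving Virasoro algebra -/
  L : ℤ → Module.End ℂ V
  /-- the right moving Virasoro algebra -/
  Lt : ℤ → Module.End ℂ V
  virasoro : IsVirasoro c L
  virasoro_t : IsVirasoro c Lt
  L_comm : ∀ m n, L m * Lt n = Lt n * L m
  mem_gr : ∀ w v, v ∈ gr w ↔ L 0 v = (w.1 : ℂ) • v ∧ Lt 0 v = (w.2 : ℂ) • v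
  mode_L : ∀ n : ℤ, mode (L (-2) vac) (-(n : ℝ), 0) = L n
  mode_Lt : ∀ n : ℤ, mode (Lt (-2) vac) (0, -(n : ℝ)) = Lt n
  /-- `Y(L_{-1} u)` is the `z` derivative of `Y(u)` -/
  deriv_L : ∀ κ, ∀ u ∈ gr κ, ∀ a, mode (L (-1) u) a = ((a.1 - κ.1 : ℝ) : ℂ) • mode u a
  /-- `Y(Lt_{-1} u)` is the `conj z` derivative of `Y(u)` -/
  deriv_Lt : ∀ κ, ∀ u ∈ gr κ, ∀ a, mode (Lt (-1) u) a = ((a.2 - κ.2 : ℝ) : ℂ) • mode u a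

/-- Partial sums `m_1 + ... + m_j` of a tuple. -/
def partialSum {k : ℕ} (m : Fin k → ℝ) (j : Fin k) : ℝ := ∑ i ∈ Finset.Iic j, m i

/-- The time ordered integral
`∫_{s_k = r}^{b} s_k^{2 m_k - 1} ∫_{s_{k-1} = r}^{s_k} s_{k-1}^{2 m_{k-1} - 1} ...
∫_{s_1 = r}^{s_2} s_1^{2 m_1 - 1} ds_1 ... ds_k`. -/
def timeOrdered (r : ℝ) : (k : ℕ) → (Fin k → ℝ) → ℝ → ℝ
  | 0, _, _ => 1
  | k + 1, m, b => ∫ s in r..b, s ^ (2 * m (Fin.last k) - 1) *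
      timeOrdered r k (fun i => m i.castSucc) s

namespace ConformalFieldTheory

variable {V : Type*} [AddCommGroup V] [Module ℂ V] (T : ConformalFieldTheory V)

/-- The product-completed state space. -/
abbrev Hat : Type _ := (w : ℝ × ℝ) → T.gr w

/-- `u` is primary of weight `(1,1)`. -/
def IsPrimary (u : V) : Prop :=
  u ∈ T.gr (1, 1) ∧ ∀ n : ℤ, 0 < n → T.L n u = 0 ∧ T.Lt n u = 0

/-- An `N = 1` supersymmetry of both chiralities, with `G k = G_{k + 1/2}`. -/
structure N1Supersymmetry where
  G : ℤ → Module.End ℂ V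
  Gt : ℤ → Module.End ℂ V
  left : IsNeveuSchwarz T.c T.L G
  right : IsNeveuSchwarz T.c T.Lt Gt
  comm_left : ∀ m k, T.Lt m * G k = G k * T.Lt m
  comm_right : ∀ m k, T.L m * Gt k = Gt k * T.L m
  anticomm : ∀ j k, G j * Gt k = -(Gt k * G j)
  mode_G : ∀ k : ℤ, T.mode (G (-2) T.vac) (-(k + 1 / 2 : ℝ), 0) = G k
  mode_Gt : ∀ k : ℤ, T.mode (Gt (-2) T.vac) (0, -(k + 1 / 2 : ℝ)) = Gt k

/-- `u` is a superconformal primary field of weight `(1/2,1/2)`. -/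
def N1Supersymmetry.IsPrimary {T : ConformalFieldTheory V} (S : T.N1Supersymmetry) (u : V) :
    Prop :=
  u ∈ T.gr (1 / 2, 1 / 2) ∧ (∀ n : ℤ, 0 < n → T.L n u = 0 ∧ T.Lt n u = 0) ∧
    ∀ k : ℤ, 0 ≤ k → S.G k u = 0 ∧ S.Gt k u = 0

/-- An `N = 2` supersymmetry of both chiralities, with `Gp k = G^+_{k + 1/2}` and
`Gm k = G^-_{k + 1/2}`. -/
structure N2Supersymmetry where
  J : ℤ → Module.End ℂ V
  Gp : ℤ → Module.End ℂ V
  Gm : ℤ → Module.End ℂ V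
  Jt : ℤ → Module.End ℂ V
  Gpt : ℤ → Module.End ℂ V
  Gmt : ℤ → Module.End ℂ V
  left : IsN2Algebra T.c T.L J Gp Gm
  right : IsN2Algebra T.c T.Lt Jt Gpt Gmt
  comm_left : ∀ m k, Commute (T.Lt m) (J k) ∧ Commute (T.Lt m) (Gp k) ∧
    Commute (T.Lt m) (Gm k) ∧ Commute (Jt m) (J k) ∧ Commute (Jt m) (Gp k) ∧
    Commute (Jt m) (Gm k)
  comm_right : ∀ m k, Commute (T.L m) (Jt k) ∧ Commute (T.L m) (Gpt k) ∧
    Commute (T.L m) (Gmt k) ∧ Commute (J m) (Gpt k) ∧ Commute (J m) (Gmt k)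
  anticomm : ∀ j k, Gp j * Gpt k = -(Gpt k * Gp j) ∧ Gp j * Gmt k = -(Gmt k * Gp j) ∧
    Gm j * Gpt k = -(Gpt k * Gm j) ∧ Gm j * Gmt k = -(Gmt k * Gm j)
  mode_J : ∀ n : ℤ, T.mode (J (-1) T.vac) (-(n : ℝ), 0) = J n
  mode_Jt : ∀ n : ℤ, T.mode (Jt (-1) T.vac) (0, -(n : ℝ)) = Jt n
  mode_Gp : ∀ k : ℤ, T.mode (Gp (-2) T.vac) (-(k + 1 / 2 : ℝ), 0) = Gp k
  mode_Gm : ∀ k : ℤ, T.mode (Gm (-2) T.vac) (-(k + 1 / 2 : ℝ), 0) = Gm k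
  mode_Gpt : ∀ k : ℤ, T.mode (Gpt (-2) T.vac) (0, -(k + 1 / 2 : ℝ)) = Gpt k
  mode_Gmt : ∀ k : ℤ, T.mode (Gmt (-2) T.vac) (0, -(k + 1 / 2 : ℝ)) = Gmt k

/-- `u` is a `cc` field of weight `(1/2,1/2)`: primary for both `N = 2` algebras and chiral on
both sides. -/
def N2Supersymmetry.IsCC {T : ConformalFieldTheory V} (S : T.N2Supersymmetry) (u : V) : Prop :=
  u ∈ T.gr (1 / 2, 1 / 2) ∧
  (∀ n : ℤ, 0 < n → T.L n u = 0 ∧ T.Lt n u = 0 ∧ S.J n u = 0 ∧ S.Jt n u = 0) ∧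
  (∀ k : ℤ, 0 ≤ k → S.Gp k u = 0 ∧ S.Gm k u = 0 ∧ S.Gpt k u = 0 ∧ S.Gmt k u = 0) ∧
  S.Gp (-1) u = 0 ∧ S.Gpt (-1) u = 0

/-- The value `y` of an operator `A` on an element `x` of the completed state space. -/
def HatApply (A : V →ₗ[ℂ] T.Hat) (x y : T.Hat) : Prop :=
  ∀ ω, WeakHasSum (fun w => (A (x w) ω : V)) (y ω : V)

/-- `x` has weight `> (Δ, Δ)`: every nonzero component has both weights `> Δ`. -/
def HasWeightGT (Δ : ℝ) (x : T.Hat) : Prop := ∀ w, x w ≠ 0 → Δ < w.1 ∧ Δ < w.2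

/-- Components off the diagonal vanish (invariance under rotations). -/
def IsSpinless (x : T.Hat) : Prop := ∀ w : ℝ × ℝ, w.1 ≠ w.2 → x w = 0

/-- The `ε^k` coefficient of `U_{A_r}(ε) u(ε) = r^{2Δ} u(ε)` for all `r ∈ (0,1)`, where
`u(ε) = ∑ f j ε^j` and `U_{A_r}(ε) = ∑ U j r ε^j`. -/
def IsAnnulusPrimaryAt (Δ : ℝ) (U : ℕ → ℝ → V →ₗ[ℂ] T.Hat) (f : ℕ → T.Hat) (k : ℕ) : Prop :=
  ∀ r ∈ Set.Ioo (0 : ℝ) 1, ∃ y : ℕ → T.Hat,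
    (∀ j ≤ k, T.HatApply (U (k - j) r) (f j) (y j)) ∧
    ∑ j ∈ Finset.range (k + 1), y j = ((r ^ (2 * Δ) : ℝ) : ℂ) • f k

/-- The open annulus `r < |x| < 1`. -/
def annulus (r : ℝ) : Set ℂ := {x | r < ‖x‖ ∧ ‖x‖ < 1}

/-- One summand of the amplitude of `A_r` with the order `j` correction of the deforming
field inserted at `x`, through a disk of radius `ρ`. The annulus is cut along the circle through
`x` into `A_{|x|}` (outside, to order `i`) and a rescaled `A_{r/|x|}` (inside, to order `l`);
`β` and `α` are the weights of the states on the two sides of the insertion, and `κ` is the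
weight of a component of `f j`. The field inserted is `Θ (f j κ)`, of weight
`κ + (1 - Δ, 1 - Δ)`. As for a density, the amplitude is divided by `ρ^2`; the surface measure
is normalized by `1 / (2π)`. -/
def insertion (Δ : ℝ) (Θ : Module.End ℂ V) (U : ℕ → ℝ → V →ₗ[ℂ] T.Hat) (f : ℕ → T.Hat)
    (r : ℝ) (v : V) (ω : ℝ × ℝ) (φ : Module.Dual ℂ V) (ρ : ℝ)
    (i j l : ℕ) (κ β α : ℝ × ℝ) (x : ℂ) : ℂ :=
  ((2 * Real.pi)⁻¹ * (ρ ^ 2)⁻¹ * (ρ / ‖x‖) ^ (κ.1 + κ.2 + 2 * (1 - Δ)) : ℝ) *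
    zpair (x / (‖x‖ : ℂ)) (α - β - (κ + (1 - Δ, 1 - Δ))) *
    φ (U i ‖x‖ (T.mode (Θ (f j κ)) (α - β) (U l (r / ‖x‖) v β)) ω)

/-- A perturbative deformation, to order `h`, of the annulus amplitudes of the theory along the
field `u` of weight `(Δ, Δ)`, where the weight `(1,1)` field which is integrated over the
worldsheet is `Θ` of the deforming field. The data are the coefficients `U k r` of
`U_{A_r}(ε)` for `k ≤ h` and the corrections `f k` of the deforming field for `k < h`. -/
structure IsDeformation (Δ : ℝ) (Θ : Module.End ℂ V) (u : V) (h : ℕ)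
    (U : ℕ → ℝ → V →ₗ[ℂ] T.Hat) (f : ℕ → T.Hat) : Prop where
  field_zero : (f 0 (Δ, Δ) : V) = u ∧ ∀ w, w ≠ (Δ, Δ) → f 0 w = 0
  annulus_zero : ∀ r ∈ Set.Ioo (0 : ℝ) 1, ∀ κ, ∀ v ∈ T.gr κ,
    (U 0 r v κ : V) = ((r ^ (κ.1 + κ.2) : ℝ) : ℂ) • v ∧ ∀ ω, ω ≠ κ → U 0 r v ω = 0
  /-- `U_{A_{rs}}(ε) = U_{A_r}(ε) U_{A_s}(ε)` -/
  gluing : ∀ k ≤ h, ∀ r ∈ Set.Ioo (0 : ℝ) 1, ∀ s ∈ Set.Ioo (0 : ℝ) 1, ∀ κ, ∀ v ∈ T.gr κ,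
    ∀ (ω : ℝ × ℝ) (φ : Module.Dual ℂ V),
    HasSum (fun p : {p : ℕ × ℕ // p.1 + p.2 = k} × (ℝ × ℝ) =>
      φ (U p.1.1.1 r (U p.1.1.2 s v p.2) ω)) (φ (U k (r * s) v ω))
  /-- `d U_{A_r}(ε) / d ε` is the integral over `x ∈ A_r` of the amplitude with the deforming
  field inserted at `x`, through a disk whose radius `ρ` is shrunk to zero. -/
  flow : ∀ k < h, ∀ r ∈ Set.Ioo (0 : ℝ) 1, ∀ κ₀, ∀ v ∈ T.gr κ₀,
    ∀ (ω : ℝ × ℝ) (φ : Module.Dual ℂ V), ∃ R : ℝ → ℂ,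
      (∀ᶠ ρ in 𝓝[>] (0 : ℝ),
        (∀ i j l : ℕ, i + j + l = k → ∀ κ β α : ℝ × ℝ,
          IntegrableOn (T.insertion Δ Θ U f r v ω φ ρ i j l κ β α) (annulus r)) ∧
        HasSum (fun p : {p : ℕ × ℕ × ℕ // p.1 + p.2.1 + p.2.2 = k} ×
            (ℝ × ℝ) × (ℝ × ℝ) × (ℝ × ℝ) =>
          ∫ x in annulus r, T.insertion Δ Θ U f r v ω φ ρ
            p.1.1.1 p.1.1.2.1 p.1.1.2.2 p.2.1 p.2.2.1 p.2.2.2 x) (R ρ)) ∧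
      Tendsto R (𝓝[>] 0) (𝓝 (((k : ℂ) + 1) * φ (U (k + 1) r v ω)))
  spinless : ∀ k < h, T.IsSpinless (f k)
  primary : ∀ k < h, T.IsAnnulusPrimaryAt Δ U f k

/-- `x` is a possible next correction of the deforming field: with `x` as its order `h`
coefficient the deformed field is still of weight `(Δ, Δ)` with respect to the deformed
annuli, to order `h`. -/
def IsNextCorrection (Δ : ℝ) (h : ℕ) (U : ℕ → ℝ → V →ₗ[ℂ] T.Hat) (f : ℕ → T.Hat)
    (x : T.Hat) : Prop :=
  T.IsSpinless x ∧ T.IsAnnulusPrimaryAt Δ U (Function.update f h x) h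

/-- The operator `v_{m_k,m_k} ... v_{m_1,m_1}`. -/
def modeProd (v : V) : (k : ℕ) → (Fin k → ℝ) → Module.End ℂ V
  | 0, _ => 1
  | k + 1, m => T.mode v (m (Fin.last k), m (Fin.last k)) *
      modeProd v k (fun i => m i.castSucc)

/-- Absolute convergence, up to order `h`, of the mode series for the annuli and of the series
obtained when the mode series for the annuli is applied to the one for the deforming
field. -/
structure ModeSeriesConverge (v u : V) (h : ℕ) : Prop where
  annulus : ∀ k ≤ h, ∀ r ∈ Set.Ioo (0 : ℝ) 1, ∀ (y : V) (M : ℝ), ∃ x : V,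
    WeakHasSum (Set.indicator {m : Fin k → ℝ | ∑ i, m i = M}
      (fun m => (timeOrdered r k m 1 : ℂ) • T.modeProd v k m y)) x
  composite : ∀ k l : ℕ, k + l ≤ h → ∀ r ∈ Set.Ioo (0 : ℝ) 1, ∀ M : ℝ, ∃ x : V,
    WeakHasSum (Set.indicator {p : (Fin k → ℝ) × (Fin l → ℝ) |
        (∀ j, partialSum p.1 j ≠ 0) ∧ ∑ i, p.1 i + ∑ i, p.2 i = M}
      (fun p => ((timeOrdered r l p.2 1 * r ^ (2 * ∑ i, p.1 i) *
          (2 ^ k * ∏ j, partialSum p.1 j)⁻¹ : ℝ) : ℂ) •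
        T.modeProd v l p.2 (T.modeProd v k p.1 u))) x

/-- `x` is the sum over all `m_1, ..., m_h` of the time ordered integrals
`∫ ... ∫ s_h^{2 m_h - 1} ... s_1^{2 m_1 - 1} v_{m_h,m_h} ... v_{m_1,m_1} ds_1 ... ds_h`
applied to `U_{A_r} y = r^{κ.1 + κ.2} y`, for `y` of weight `κ`. -/
def IsTimeOrderedSeries (v : V) (h : ℕ) (r : ℝ) (κ : ℝ × ℝ) (y : V) (x : T.Hat) : Prop :=
  ∀ ω : ℝ × ℝ, WeakHasSum
    (Set.indicator {m : Fin h → ℝ | κ + (∑ i, m i, ∑ i, m i) = ω}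
      (fun m => (timeOrdered r h m 1 : ℂ) •
        T.modeProd v h m (((r ^ (κ.1 + κ.2) : ℝ) : ℂ) • y))) (x ω : V)

/-- Apart from its component of weight `(Δ, Δ)`, `x` is the sum over `m_1, ..., m_h` of
`v_{m_h,m_h} ... v_{m_1,m_1} u / (2^h (m_h + ... + m_1) ... m_1)`. -/
def IsCorrectionSeries (Δ : ℝ) (v u : V) (h : ℕ) (x : T.Hat) : Prop :=
  T.IsSpinless x ∧ ∀ M : ℝ, M ≠ 0 → WeakHasSum
    (Set.indicator {m : Fin h → ℝ | (∀ j, partialSum m j ≠ 0) ∧ ∑ i, m i = M}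
      (fun m => (((2 ^ h * ∏ j, partialSum m j)⁻¹ : ℝ) : ℂ) • T.modeProd v h m u))
    (x (Δ + M, Δ + M) : V)

/-- The sum of the terms with `m_1 + ... + m_h = 0`, the vanishing factor of the denominator
being omitted, is zero. -/
def ObstructionVanishes (v u : V) (h : ℕ) : Prop :=
  WeakHasSum
    (Set.indicator {m : Fin h → ℝ |
        (∀ j : Fin h, (j : ℕ) + 1 < h → partialSum m j ≠ 0) ∧ ∑ i, m i = 0}
      (fun m => (((2 ^ h * ∏ j ∈ Finset.univ.filter (fun j : Fin h => (j : ℕ) + 1 < h),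
          partialSum m j)⁻¹ : ℝ) : ℂ) •
        T.modeProd v h m u)) 0

end ConformalFieldTheory

end

/-! For (a), the component of weight κ of the deforming field enters the flow equation with the
factor ρ^(κ₁+κ₂-2Δ). Since the corrections have weight above (Δ,Δ), only v = Θu survives as ρ → 0
(`hasSum_of_tendsto_rpow`), and the angular integral selects the modes v_{m,m}. What remains is
(n+1) U^{n+1}_{A_r} = ∑_{i+l=n} ∑_m ∫_r^1 U^i_{A_s} v_{m,m} U^l_{A_{r/s}} ds/s. By induction U^i and
U^l are time ordered series. Each product is then the time ordered integral over n+1 points, cut at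
point l+1, so each of the n+1 cuts reproduces the whole series and the factor n+1 cancels. Sums and
integrals may be exchanged because the time ordered integrals are positive: convergence of the
integrated series is already the Fubini hypothesis (`hasSum_integral_fiberwise`).

For (b), the series for u^k is inserted into U^l u^k with k+l = n+1 = h. Let R_{k,l} be this
composite series with its weight replaced by an ordered integral over the l annulus points with
innermost factor s^(2(m_1+⋯+m_k)). The innermost integration gives (s^(2σ) - r^(2σ))/(2σ), where σ
is the next partial sum. The upper endpoint yields R_{k+1,l-1}, the lower one minus the series of
U^{l-1} u^{k+1} (`compositeTerm_resummed_snoc`). Hence the sums telescope, and R_{k,l} adds up the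
contributions of u^0, …, u^k, up to the common factor r^(2Δ). Terms with σ = 0 produce logarithms
multiplying the obstruction of order k+1, which vanishes because u^{k+1} exists
(`hasSum_compositeTerm_of_obstruction`).

At k = n a single integral is left: (1-r^(2M))/(2M) in relative weight M ≠ 0, and -log r for M = 0.
Comparison with the equation for u^h gives the series (2) in the first case and the obstruction in
the second. The convergence of (2) is a by-product, so (c) follows from (b). -/

noncomputable section

/-! ### Ordered iterated integrals -/

section OrderedIntegrals

open Set intervalIntegral

/-- The time ordered integral whose innermost integrand carries the additional factor `g`. -/
def orderedIntegral (r : ℝ) (g : ℝ → ℝ) : (k : ℕ) → (Fin k → ℝ) → ℝ → ℝ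
  | 0, _, b => g b
  | k + 1, m, b => ∫ s in r..b, s ^ (2 * m (Fin.last k) - 1) *
      orderedIntegral r g k (fun i => m i.castSucc) s

theorem timeOrdered_eq_orderedIntegral (r : ℝ) (k : ℕ) (m : Fin k → ℝ) :
    timeOrdered r k m = orderedIntegral r 1 k m := by
  induction k with
  | zero => rfl
  | succ k ih => funext b; simp only [timeOrdered, orderedIntegral, ih]

theorem uIcc_subset_Ioi_zero {r b : ℝ} (hr : 0 < r) (hb : 0 < b) : uIcc r b ⊆ Ioi 0 :=
  fun _ hx => lt_of_lt_of_le (lt_min hr hb) hx.1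

theorem continuousOn_rpow_Ioi (p : ℝ) : ContinuousOn (fun s : ℝ => s ^ p) (Ioi 0) :=
  fun s hs => (Real.continuousAt_rpow_const s p (Or.inl (ne_of_gt hs))).continuousWithinAt

theorem ContinuousOn.intervalIntegrable_Ioi {f : ℝ → ℝ} (hf : ContinuousOn f (Ioi 0)) {r b : ℝ}
    (hr : 0 < r) (hb : 0 < b) : IntervalIntegrable f volume r b :=
  (hf.mono (uIcc_subset_Ioi_zero hr hb)).intervalIntegrable

theorem continuousOn_primitive_Ioi {f : ℝ → ℝ} (hf : ContinuousOn f (Ioi 0)) {r : ℝ}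
    (hr : 0 < r) : ContinuousOn (fun b => ∫ s in r..b, f s) (Ioi 0) := by
  intro b hb
  have h := integral_hasDerivAt_right (hf.intervalIntegrable_Ioi hr hb)
    (hf.stronglyMeasurableAtFilter isOpen_Ioi b hb) (hf.continuousAt (Ioi_mem_nhds hb))
  exact h.continuousAt.continuousWithinAt

theorem continuousOn_orderedIntegral {r : ℝ} (hr : 0 < r) {g : ℝ → ℝ}
    (hg : ContinuousOn g (Ioi 0)) (k : ℕ) (m : Fin k → ℝ) :
    ContinuousOn (orderedIntegral r g k m) (Ioi 0) := by
  induction k with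
  | zero => exact hg
  | succ k ih => exact continuousOn_primitive_Ioi ((continuousOn_rpow_Ioi _).mul (ih _)) hr

theorem continuousOn_timeOrdered {r : ℝ} (hr : 0 < r) (k : ℕ) (m : Fin k → ℝ) :
    ContinuousOn (timeOrdered r k m) (Ioi 0) := by
  rw [timeOrdered_eq_orderedIntegral]
  exact continuousOn_orderedIntegral hr continuousOn_const k m

theorem orderedIntegral_congr {r b : ℝ} (hr : 0 < r) (hb : 0 < b) {g g' : ℝ → ℝ}
    (h : ∀ s, 0 < s → g s = g' s) (k : ℕ) (m : Fin k → ℝ) :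
    orderedIntegral r g k m b = orderedIntegral r g' k m b := by
  induction k generalizing b with
  | zero => exact h b hb
  | succ k ih =>
    refine integral_congr fun s hs => ?_
    simp only [ih (uIcc_subset_Ioi_zero hr hb hs)]

theorem orderedIntegral_pos {r b : ℝ} (hr : 0 < r) (hb : r < b) {g : ℝ → ℝ}
    (hc : ContinuousOn g (Ioi 0)) (hg : ∀ s, r < s → 0 < g s) (k : ℕ) (m : Fin k → ℝ) :
    0 < orderedIntegral r g k m b := by
  induction k generalizing b with
  | zero => exact hg b hb
  | succ k ih =>
    refine intervalIntegral_pos_of_pos_on ?_ (fun s hs => ?_) hb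
    · exact ((continuousOn_rpow_Ioi _).mul
        (continuousOn_orderedIntegral hr hc k _)).intervalIntegrable_Ioi hr (hr.trans hb)
    · exact mul_pos (Real.rpow_pos_of_pos (hr.trans hs.1) _) (ih hs.1 _)

theorem timeOrdered_pos {r b : ℝ} (hr : 0 < r) (hb : r < b) (k : ℕ) (m : Fin k → ℝ) :
    0 < timeOrdered r k m b := by
  rw [timeOrdered_eq_orderedIntegral]
  exact orderedIntegral_pos hr hb continuousOn_const (fun _ _ => one_pos) k m

/-- Substitute s ↦ cs in every integral. This turns the amplitude of the rescaled inner annulus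
`A_{r/s}` into an integral over points between r and s. -/
theorem timeOrdered_mul {c r b : ℝ} (hc : 0 < c) (hr : 0 < r) (hb : 0 < b) (k : ℕ)
    (m : Fin k → ℝ) :
    timeOrdered (c * r) k m (c * b) = c ^ (2 * ∑ i, m i) * timeOrdered r k m b := by
  induction k generalizing b with
  | zero => simp [timeOrdered]
  | succ k ih =>
    simp only [timeOrdered]
    rw [← smul_integral_comp_mul_left, smul_eq_mul, ← intervalIntegral.integral_const_mul, ← intervalIntegral.integral_const_mul]
    refine integral_congr fun s hs => ?_
    have hs' : 0 < s := uIcc_subset_Ioi_zero hr hb hs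
    simp only [ih hs', Fin.sum_univ_castSucc, mul_add]
    rw [Real.mul_rpow hc.le hs'.le, Real.rpow_add hc, Real.rpow_sub hc, Real.rpow_one]
    field_simp

/-- The definition recurses on the outermost point; here the innermost integral is absorbed into the
factor `g`, so that integrals can be peeled off from the inside. -/
theorem orderedIntegral_cons (r : ℝ) (g : ℝ → ℝ) (k : ℕ) (t : ℝ) (m : Fin k → ℝ) (b : ℝ) :
    orderedIntegral r g (k + 1) (Fin.cons t m) b =
      orderedIntegral r (fun s => ∫ x in r..s, x ^ (2 * t - 1) * g x) k m b := by
  induction k generalizing b with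
  | zero => rfl
  | succ k ih =>
    rw [orderedIntegral, orderedIntegral]
    have h : (fun i : Fin (k + 1) => (Fin.cons t m : Fin (k + 2) → ℝ) i.castSucc) =
        Fin.cons t (fun i => m i.castSucc) := by
      funext i
      refine Fin.cases rfl (fun i => ?_) i
      rfl
    simp only [h, ih]
    rfl

theorem orderedIntegral_mul_sub {r b : ℝ} (hr : 0 < r) (hb : 0 < b) {g : ℝ → ℝ}
    (hg : ContinuousOn g (Ioi 0)) (c d : ℝ) (k : ℕ) (m : Fin k → ℝ) :
    orderedIntegral r (fun s => c * (g s - d)) k m b =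
      c * (orderedIntegral r g k m b - d * timeOrdered r k m b) := by
  induction k generalizing b with
  | zero => simp [orderedIntegral, timeOrdered]
  | succ k ih =>
    simp only [orderedIntegral, timeOrdered]
    have h1 := ((continuousOn_rpow_Ioi (2 * m (Fin.last k) - 1)).mul
      (continuousOn_orderedIntegral hr hg k fun i => m i.castSucc)).intervalIntegrable_Ioi hr hb
    have h2 := ((continuousOn_rpow_Ioi (2 * m (Fin.last k) - 1)).mul
      (continuousOn_timeOrdered hr k fun i => m i.castSucc)).intervalIntegrable_Ioi hr hb
    have h3 := integral_sub h1 (h2.const_mul d)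
    simp only [Pi.mul_apply] at h3
    rw [← intervalIntegral.integral_const_mul d, ← h3, ← intervalIntegral.integral_const_mul]
    refine integral_congr fun s hs => ?_
    simp only [ih (uIcc_subset_Ioi_zero hr hb hs)]
    ring

/-- Source of the telescoping: the upper endpoint of the innermost integral reproduces an integral
of the same kind with exponent shifted by `t`; the lower endpoint is a constant and leaves a plain
time ordered integral. -/
theorem orderedIntegral_rpow_cons {r b : ℝ} (hr : 0 < r) (hb : 0 < b) {p t : ℝ}
    (hpt : p + t ≠ 0) (k : ℕ) (m : Fin k → ℝ) :
    orderedIntegral r (fun s => s ^ (2 * p)) (k + 1) (Fin.cons t m) b =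
      (2 * (p + t))⁻¹ * (orderedIntegral r (fun s => s ^ (2 * (p + t))) k m b -
        r ^ (2 * (p + t)) * timeOrdered r k m b) := by
  rw [orderedIntegral_cons, ← orderedIntegral_mul_sub hr hb (continuousOn_rpow_Ioi _)]
  refine orderedIntegral_congr hr hb (fun s hs => ?_) k m
  have : ∫ x in r..s, x ^ (2 * t - 1) * x ^ (2 * p) = ∫ x in r..s, x ^ (2 * (p + t) - 1) := by
    refine integral_congr fun x hx => ?_
    have hx' : 0 < x := uIcc_subset_Ioi_zero hr hs hx
    simp only [← Real.rpow_add hx']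
    ring_nf
  rw [this, integral_rpow]
  · rw [sub_add_cancel, div_eq_inv_mul]
  · refine Or.inr ⟨fun h => hpt (by linarith), fun h => ?_⟩
    exact lt_irrefl (0 : ℝ) (uIcc_subset_Ioi_zero hr hs h)

/-- In the resonant case the innermost integrand is 1/x. The result no longer depends on `p` and
`t`, which lets the obstruction be factored out later. -/
theorem orderedIntegral_rpow_cons_of_add_eq_zero {r b : ℝ} (hr : 0 < r) (hb : 0 < b) {p t : ℝ}
    (hpt : p + t = 0) (k : ℕ) (m : Fin k → ℝ) :
    orderedIntegral r (fun s => s ^ (2 * p)) (k + 1) (Fin.cons t m) b =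
      orderedIntegral r (fun s => Real.log (s / r)) k m b := by
  rw [orderedIntegral_cons]
  refine orderedIntegral_congr hr hb (fun s hs => ?_) k m
  rw [← integral_inv fun h => lt_irrefl (0 : ℝ) (uIcc_subset_Ioi_zero hr hs h)]
  refine integral_congr fun x hx => ?_
  have hx' : 0 < x := uIcc_subset_Ioi_zero hr hs hx
  simp only [← Real.rpow_add hx']
  rw [show 2 * t - 1 + 2 * p = -1 by linarith, Real.rpow_neg_one]

/-- Fubini on the triangle r < s < x ≤ B, whose closure is compact in the open quadrant where `F` is
continuous. -/
theorem integral_integral_triangle {F : ℝ → ℝ → ℝ}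
    (hF : ContinuousOn (Function.uncurry F) (Ioi 0 ×ˢ Ioi 0)) {r B : ℝ} (hr : 0 < r)
    (hB : r ≤ B) :
    ∫ s in r..B, ∫ x in s..B, F s x = ∫ x in r..B, ∫ s in r..x, F s x := by
  have hsub : Icc r B ×ˢ Icc r B ⊆ (Ioi 0 ×ˢ Ioi 0 : Set (ℝ × ℝ)) :=
    prod_mono (fun _ h => hr.trans_le h.1) (fun _ h => hr.trans_le h.1)
  have hI : IntegrableOn (Function.uncurry F) (Ioc r B ×ˢ Ioc r B) (volume.prod volume) :=
    ((hF.mono hsub).integrableOn_compact (isCompact_Icc.prod isCompact_Icc)).mono_set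
      (prod_mono Ioc_subset_Icc_self Ioc_subset_Icc_self)
  have hT : MeasurableSet {p : ℝ × ℝ | p.1 < p.2} := measurableSet_lt measurable_fst measurable_snd
  have hI' : Integrable (Function.uncurry fun s x => {p : ℝ × ℝ | p.1 < p.2}.indicator
      (Function.uncurry F) (s, x))
      ((volume.restrict (Ioc r B)).prod (volume.restrict (Ioc r B))) := by
    rw [Measure.prod_restrict]
    exact hI.indicator hT
  have hswap := integral_integral_swap hI'
  rw [integral_of_le hB, integral_of_le hB]
  calc _ = ∫ s in Ioc r B, ∫ x in Ioc r B, {p : ℝ × ℝ | p.1 < p.2}.indicator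
        (Function.uncurry F) (s, x) := by
        refine setIntegral_congr_fun measurableSet_Ioc fun s hs => ?_
        rw [integral_of_le hs.2,
          show (fun x => {p : ℝ × ℝ | p.1 < p.2}.indicator (Function.uncurry F) (s, x)) =
            (Ioi s).indicator (F s) from rfl, setIntegral_indicator measurableSet_Ioi]
        congr 2
        ext x
        simp only [mem_Ioc, mem_inter_iff, mem_Ioi]
        exact ⟨fun h => ⟨⟨hs.1.trans h.1, h.2⟩, h.1⟩, fun h => ⟨h.2, h.1.2⟩⟩
    _ = _ := hswap
    _ = _ := by
        refine setIntegral_congr_fun measurableSet_Ioc fun x hx => ?_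
        rw [integral_of_le hx.1.le, integral_Ioc_eq_integral_Ioo (y := x),
          show (fun s => {p : ℝ × ℝ | p.1 < p.2}.indicator (Function.uncurry F) (s, x)) =
            (Iio x).indicator (fun s => F s x) from rfl, setIntegral_indicator measurableSet_Iio]
        congr 2
        ext s
        simp only [mem_Ioc, mem_inter_iff, mem_Iio, mem_Ioo]
        exact ⟨fun h => ⟨h.1.1, h.2⟩, fun h => ⟨⟨h.1, h.2.le.trans hx.2⟩, h.2⟩⟩

/-- By scaling, the value is a power of the lower limit times a function of the ratio of the limits,
so continuity in one variable suffices. -/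
theorem continuousOn_timeOrdered_uncurry (k : ℕ) (m : Fin k → ℝ) :
    ContinuousOn (Function.uncurry fun s x => timeOrdered s k m x) (Ioi 0 ×ˢ Ioi 0) := by
  have h : ContinuousOn (fun p : ℝ × ℝ => p.1 ^ (2 * ∑ i, m i) * timeOrdered 1 k m (p.2 / p.1))
      (Ioi 0 ×ˢ Ioi 0) := by
    refine ContinuousOn.mul ?_ ?_
    · exact (continuousOn_rpow_Ioi _).comp continuousOn_fst fun p hp => hp.1
    · refine (continuousOn_timeOrdered one_pos k m).comp ?_ fun p hp => mem_Ioi.2 (div_pos hp.2 hp.1)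
      exact continuousOn_snd.div continuousOn_fst fun p hp => ne_of_gt hp.1
  refine h.congr fun p hp => ?_
  have h1 : 0 < p.1 := hp.1
  have := timeOrdered_mul h1 one_pos (div_pos hp.2 hp.1) k m
  rw [mul_one, mul_div_cancel₀ _ h1.ne'] at this
  exact this

/-- A time ordered integral may be cut at the position of an intermediate insertion. -/
theorem integral_mul_timeOrdered {f : ℝ → ℝ} (hf : ContinuousOn f (Ioi 0)) {r B : ℝ}
    (hr : 0 < r) (hB : r ≤ B) (k : ℕ) (m : Fin k → ℝ) :
    ∫ s in r..B, f s * timeOrdered s k m B =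
      orderedIntegral r (fun s => ∫ x in r..s, f x) k m B := by
  induction k generalizing B with
  | zero => simp [timeOrdered, orderedIntegral]
  | succ k ih =>
    simp only [timeOrdered, orderedIntegral, ← intervalIntegral.integral_const_mul]
    -- The outermost point is moved outside the cut, where the induction hypothesis applies with
    -- that point as upper limit.
    rw [integral_integral_triangle _ hr hB]
    · refine integral_congr fun x hx => ?_
      rw [uIcc_of_le hB] at hx
      simp only [← ih hx.1]
      rw [← intervalIntegral.integral_const_mul]
      refine integral_congr fun s _ => ?_
      ring
    · refine ContinuousOn.mul (hf.comp continuousOn_fst fun p hp => hp.1) (ContinuousOn.mul ?_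
        (continuousOn_timeOrdered_uncurry k _))
      exact (continuousOn_rpow_Ioi _).comp continuousOn_snd fun p hp => hp.2

/-- The ordered integral over `l + 1 + i` points, cut at an intermediate point `s`. -/
theorem integral_timeOrdered_mul_timeOrdered {r : ℝ} (hr : 0 < r) (hr1 : r ≤ 1) (l i : ℕ)
    (a : Fin l → ℝ) (t : ℝ) (b : Fin i → ℝ) :
    ∫ s in r..1, s ^ (2 * t - 1) * timeOrdered r l a s * timeOrdered s i b 1 =
      orderedIntegral r (timeOrdered r l a) (i + 1) (Fin.cons t b) 1 := by
  rw [orderedIntegral_cons]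
  exact integral_mul_timeOrdered
    ((continuousOn_rpow_Ioi _).mul (continuousOn_timeOrdered hr l a)) hr hr1 i b

/-- Both sides integrate over the same l + 1 + i ordered points; only the group to which the middle
one is assigned differs. -/
theorem orderedIntegral_timeOrdered_cons (r : ℝ) (l i : ℕ)
    (a : Fin l → ℝ) (t : ℝ) (b : Fin i → ℝ) (B : ℝ) :
    orderedIntegral r (timeOrdered r l a) (i + 1) (Fin.cons t b) B =
      orderedIntegral r (timeOrdered r (l + 1) (Fin.snoc a t)) i b B := by
  rw [orderedIntegral_cons]
  congr 1
  funext s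
  simp [timeOrdered]

end OrderedIntegrals

end

noncomputable section

/-! ### Summation lemmas -/

section Summation

theorem HasSum.of_eq {ι : Type*} {f g : ι → ℂ} {x y : ℂ} (h : HasSum f x)
    (hfg : ∀ i, g i = f i) (hxy : y = x) : HasSum g y := by
  rwa [funext hfg, hxy]

theorem HasSum.fiberwise {ι P : Type*} {g : ι → ℂ} {S : ℂ} (hg : HasSum g S) (π : ι → P)
    {c : P → ℂ} (hc : ∀ p, HasSum ((π ⁻¹' {p}).indicator g) (c p)) : HasSum c S := by
  refine ((Equiv.sigmaFiberEquiv π).hasSum_iff.mpr hg).sigma fun p => ?_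
  exact hasSum_subtype_iff_indicator.mpr (hc p)

/-- By Tonelli the sum of the norms has finite integral, hence is finite almost everywhere. -/
theorem ae_summable_of_summable_integral_norm {α ι E : Type*} [MeasurableSpace α]
    {μ : Measure α} [NormedAddCommGroup E] [CompleteSpace E] [Countable ι] {F : ι → α → E}
    (hF : ∀ i, Integrable (F i) μ) (hS : Summable fun i => ∫ a, ‖F i a‖ ∂μ) :
    ∀ᵐ a ∂μ, Summable fun i => F i a := by
  have h1 : ∫⁻ a, ∑' i, ‖F i a‖ₑ ∂μ ≠ ⊤ := by
    rw [lintegral_tsum fun i => (hF i).1.enorm]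
    have h2 : ∀ i, ∫⁻ a, ‖F i a‖ₑ ∂μ = ENNReal.ofReal (∫ a, ‖F i a‖ ∂μ) := fun i =>
      (ofReal_integral_norm_eq_lintegral_enorm (hF i)).symm
    simp only [h2]
    exact hS.tsum_ofReal_ne_top
  have h3 := ae_lt_top' (AEMeasurable.tsum fun i => (hF i).1.enorm) h1
  filter_upwards [h3] with a ha
  refine Summable.of_norm ?_
  have h4 : Summable fun i => ‖F i a‖₊ := ENNReal.tsum_coe_ne_top_iff_summable.1 ha.ne
  exact NNReal.summable_coe.2 h4

/-- Termwise integration of a series with positive weights, regrouped along the fibres of `π`. -/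
theorem hasSum_integral_fiberwise {α ι P : Type*} [MeasurableSpace α] {μ : Measure α}
    {c : ι → ℂ} {w : ι → α → ℝ} {W : ι → ℝ} (hw : ∀ i, Integrable (w i) μ)
    (hw0 : ∀ i, ∀ᵐ s ∂μ, 0 ≤ w i s) (hW : ∀ i, ∫ s, w i s ∂μ = W i) (hW0 : ∀ i, 0 < W i)
    {S : ℂ} (hS : HasSum (fun i => (W i : ℂ) * c i) S) (π : ι → P) {H : P → α → ℂ}
    (hH : ∀ᵐ s ∂μ, ∀ p, (Summable fun i => (w i s : ℂ) * c i) →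
      HasSum ((π ⁻¹' {p}).indicator fun i => (w i s : ℂ) * c i) (H p s)) :
    HasSum (fun p => ∫ s, H p s ∂μ) S := by
  -- The index type will consist of tuples of reals and is uncountable, but summability leaves only
  -- countably many nonzero coefficients, to which the integration theorems apply.
  have hcount : (Function.support c).Countable := by
    refine hS.summable.countable_support.mono fun i hi => ?_
    exact mul_ne_zero (Complex.ofReal_ne_zero.2 (hW0 i).ne') hi
  have : Countable (Function.support c) := hcount
  have hint : ∀ i, Integrable (fun s => (w i s : ℂ) * c i) μ := fun i =>
    (hw i).ofReal.mul_const _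
  -- Positivity of the weights: the integral of the norm equals the norm of the integral, so the
  -- given numerical series controls everything.
  have hnorm : ∀ i, ∫ s, ‖(w i s : ℂ) * c i‖ ∂μ = ‖(W i : ℂ) * c i‖ := by
    intro i
    have : ∫ s, ‖(w i s : ℂ) * c i‖ ∂μ = ∫ s, w i s * ‖c i‖ ∂μ := by
      refine integral_congr_ae ?_
      filter_upwards [hw0 i] with s hs
      rw [norm_mul, Complex.norm_of_nonneg hs]
    rw [this, integral_mul_const, hW, norm_mul, Complex.norm_of_nonneg (hW0 i).le]
  have hsum : Summable fun i : Function.support c => ‖(W i : ℂ) * c i‖ :=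
    hS.summable.norm.subtype _
  -- To be used with `c'` the restriction of `c` to one fibre of `π`.
  have hsub : ∀ c' : ι → ℂ, (∀ i, c' i = c i ∨ c' i = 0) →
      HasSum (fun i => (W i : ℂ) * c' i) (∫ s, ∑' i, (w i s : ℂ) * c' i ∂μ) := by
    intro c' hc'
    have hcc : ∀ i, ‖c' i‖ ≤ ‖c i‖ := fun i => by
      rcases hc' i with h | h <;> simp [h]
    have hs' : Function.support c' ⊆ Function.support c := fun i hi h0 => by
      rcases hc' i with h | h
      · exact hi (h.trans h0)
      · exact hi h
    have h1 := hasSum_integral_of_summable_integral_norm (μ := μ)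
      (F := fun (i : Function.support c) s => (w i s : ℂ) * c' i)
      (fun i => (hw i).ofReal.mul_const _) (by
        refine Summable.of_nonneg_of_le (fun i => integral_nonneg fun s => norm_nonneg _)
          (fun i => ?_) hsum
        rw [← hnorm]
        refine integral_mono ((hw i).ofReal.mul_const _).norm (hint i).norm fun s => ?_
        simp only [norm_mul]
        gcongr
        exact hcc i)
    have h2 : ∀ i : ι, ∫ s, (w i s : ℂ) * c' i ∂μ = (W i : ℂ) * c' i := fun i => by
      rw [integral_mul_const, ← hW i, integral_complex_ofReal]
    simp only [h2] at h1
    have h3 : ∀ s, ∑' i : Function.support c, (w i s : ℂ) * c' i = ∑' i, (w i s : ℂ) * c' i :=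
      fun s => tsum_subtype_eq_of_support_subset (f := fun i => (w i s : ℂ) * c' i)
        fun i hi => hs' (right_ne_zero_of_mul hi)
    simp only [h3] at h1
    refine (hasSum_subtype_iff_of_support_subset
      (f := fun i => (W i : ℂ) * c' i) fun i hi => hs' (right_ne_zero_of_mul hi)).1 h1
  have hint' : ∀ i : Function.support c, Integrable (fun s => (w i s : ℂ) * c i) μ :=
    fun i => hint i
  have hsum' : Summable fun i : Function.support c => ∫ s, ‖(w i s : ℂ) * c i‖ ∂μ := by
    simp only [hnorm]
    exact hsum
  have hae : ∀ᵐ s ∂μ, Summable fun i => (w i s : ℂ) * c i := by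
    have h1 := ae_summable_of_summable_integral_norm (μ := μ)
      (F := fun (i : Function.support c) s => (w i s : ℂ) * c i) hint' hsum'
    filter_upwards [h1] with s hs
    have h2 := (hasSum_subtype_iff_of_support_subset (f := fun i => (w i s : ℂ) * c i)
      (s := Function.support c) fun i hi => right_ne_zero_of_mul hi).1 hs.hasSum
    exact h2.summable
  refine hS.fiberwise π fun p => ?_
  have h1 := hsub ((π ⁻¹' {p}).indicator c) fun i => by
    by_cases hi : i ∈ π ⁻¹' {p}
    · exact Or.inl (Set.indicator_of_mem hi _)
    · exact Or.inr (Set.indicator_of_notMem hi _)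
  have h2 : ∀ (x : ι → ℂ) i, x i * (π ⁻¹' {p}).indicator c i =
      (π ⁻¹' {p}).indicator (fun i => x i * c i) i := fun x i => by
    by_cases hi : i ∈ π ⁻¹' {p} <;> simp [hi]
  have h3 : ∫ s, ∑' i, (w i s : ℂ) * (π ⁻¹' {p}).indicator c i ∂μ = ∫ s, H p s ∂μ := by
    refine integral_congr_ae ?_
    filter_upwards [hae, hH] with s hs hs'
    rw [← (hs' p hs).tsum_eq]
    exact tsum_congr (h2 fun i => (w i s : ℂ))
  rw [h3] at h1
  exact (funext (h2 fun i => (W i : ℂ))) ▸ h1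

end Summation

end

noncomputable section

/-! ### Integration over the annulus -/

section Annulus

open Set

theorem zpair_exp_mul_I {θ : ℝ} (hθ : θ ∈ Ioo (-Real.pi) Real.pi) (a : ℝ × ℝ) :
    zpair (Complex.exp (θ * Complex.I)) a = Complex.exp (((a.1 - a.2 : ℝ) * Complex.I) * θ) := by
  have h : Complex.log (Complex.exp (θ * Complex.I)) = θ * Complex.I :=
    Complex.log_exp (by simpa using hθ.1) (by simpa using hθ.2.le)
  rw [zpair, h]
  simp only [map_mul, Complex.conj_ofReal, Complex.conj_I]
  congr 1
  push_cast
  ring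

theorem integral_exp_mul_I (n : ℤ) :
    ∫ θ in Ioo (-Real.pi) Real.pi, Complex.exp (((n : ℝ) * Complex.I) * θ) =
      if n = 0 then (2 * Real.pi : ℂ) else 0 := by
  have hpi : -Real.pi ≤ Real.pi := by linarith [Real.pi_pos]
  rw [← integral_Ioc_eq_integral_Ioo, ← intervalIntegral.integral_of_le hpi]
  split_ifs with h
  · subst h
    simp
    ring
  · rw [integral_exp_mul_complex (by simpa using h)]
    have : Complex.exp ((n : ℝ) * Complex.I * (Real.pi : ℝ)) =
        Complex.exp ((n : ℝ) * Complex.I * (-Real.pi : ℝ)) := by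
      rw [Complex.exp_eq_exp_iff_exists_int]
      exact ⟨n, by push_cast; ring⟩
    rw [this, sub_self, zero_div]

/-- In polar coordinates the integrand separates, and the angular factor is the integral of exp(inθ)
over a full period, with n the spin. -/
theorem integral_annulus {r : ℝ} (hr : 0 < r) (A : ℝ → ℂ) {a : ℝ × ℝ} {n : ℤ}
    (ha : a.1 - a.2 = n) :
    ∫ x in ConformalFieldTheory.annulus r, zpair (x / (‖x‖ : ℂ)) a * A ‖x‖ =
      if a.1 = a.2 then 2 * Real.pi * ∫ s in Ioo r 1, s * A s else 0 := by
  have hmeas : MeasurableSet (ConformalFieldTheory.annulus r) :=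
    (measurableSet_lt measurable_const measurable_norm).inter
      (measurableSet_lt measurable_norm measurable_const)
  rw [← integral_indicator hmeas, ← Complex.integral_comp_polarCoord_symm]
  have h1 : ∫ p in polarCoord.target, p.1 • (ConformalFieldTheory.annulus r).indicator
      (fun x : ℂ => zpair (x / (‖x‖ : ℂ)) a * A ‖x‖) (Complex.polarCoord.symm p) =
      ∫ p in polarCoord.target, (Ioo r 1 ×ˢ Ioo (-Real.pi) Real.pi).indicator (fun p : ℝ × ℝ =>
        (p.1 * A p.1) * Complex.exp (((n : ℝ) * Complex.I) * p.2)) p := by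
    refine setIntegral_congr_fun polarCoord.open_target.measurableSet fun p hp => ?_
    have hp0 : 0 < p.1 := hp.1
    have hpθ : p.2 ∈ Ioo (-Real.pi) Real.pi := hp.2
    have hexp : Complex.polarCoord.symm p = p.1 * Complex.exp (p.2 * Complex.I) := by
      rw [Complex.polarCoord_symm_apply, Complex.exp_mul_I]
      push_cast
      rfl
    have hnorm : ‖Complex.polarCoord.symm p‖ = p.1 := by
      rw [Complex.norm_polarCoord_symm, abs_of_pos hp0]
    by_cases hpr : p.1 ∈ Ioo r 1
    · rw [indicator_of_mem (show Complex.polarCoord.symm p ∈ ConformalFieldTheory.annulus r by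
        simpa [ConformalFieldTheory.annulus, abs_of_pos hp0] using hpr),
        indicator_of_mem (show p ∈ Ioo r 1 ×ˢ Ioo (-Real.pi) Real.pi from ⟨hpr, hpθ⟩), hnorm,
        hexp, mul_div_cancel_left₀ _ (Complex.ofReal_ne_zero.2 hp0.ne'), zpair_exp_mul_I hpθ, ha,
        Complex.real_smul]
      ring
    · rw [indicator_of_notMem (show Complex.polarCoord.symm p ∉ ConformalFieldTheory.annulus r by
        simpa [ConformalFieldTheory.annulus, abs_of_pos hp0] using hpr),
        indicator_of_notMem (fun h => hpr h.1), smul_zero]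
  have hsub : polarCoord.target ∩ (Ioo r 1 ×ˢ Ioo (-Real.pi) Real.pi) =
      Ioo r 1 ×ˢ Ioo (-Real.pi) Real.pi :=
    inter_eq_right.2 fun p hp => ⟨hr.trans hp.1.1, hp.2⟩
  rw [h1, setIntegral_indicator (measurableSet_Ioo.prod measurableSet_Ioo), hsub,
    Measure.volume_eq_prod, setIntegral_prod_mul (fun s : ℝ => (s : ℂ) * A s)
      (fun θ : ℝ => Complex.exp (((n : ℝ) * Complex.I) * θ)), integral_exp_mul_I]
  have h0 : n = 0 ↔ a.1 = a.2 := by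
    rw [← sub_eq_zero (a := a.1), ha]
    exact Int.cast_eq_zero.symm
  simp only [h0, mul_ite, mul_zero]
  split_ifs <;> ring

end Annulus

/-- In a series of powers of `ρ` only the constant terms survive as `ρ → 0`. -/
theorem hasSum_of_tendsto_rpow {ι : Type*} {e : ι → ℝ} {c : ι → ℂ} {S : Set ι} {R : ℝ → ℂ}
    {a : ℂ} (hR : ∀ᶠ ρ in 𝓝[>] (0 : ℝ), HasSum (fun i => ((ρ ^ e i : ℝ) : ℂ) * c i) (R ρ))
    (ha : Tendsto R (𝓝[>] 0) (𝓝 a)) (h0 : ∀ i ∈ S, e i = 0) (hpos : ∀ i ∉ S, c i ≠ 0 → 0 < e i) :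
    HasSum (S.indicator c) a := by
  have hev : ∀ᶠ ρ in 𝓝[>] (0 : ℝ), 0 < ρ := self_mem_nhdsWithin
  -- Nonzero terms have exponent ≥ 0, so the terms at one fixed radius of convergence dominate those
  -- at all smaller radii.
  obtain ⟨ρ₀, h₀, hρ₀⟩ := (hR.and hev).exists
  have hmem : ∀ᶠ ρ in 𝓝[>] (0 : ℝ), ρ < ρ₀ :=
    nhdsWithin_le_nhds (Iio_mem_nhds hρ₀)
  have hbound : Summable fun i => ‖((ρ₀ ^ e i : ℝ) : ℂ) * c i‖ := h₀.summable.norm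
  have hlim : ∀ i, Tendsto (fun ρ : ℝ => ((ρ ^ e i : ℝ) : ℂ) * c i) (𝓝[>] 0)
      (𝓝 (S.indicator c i)) := by
    intro i
    by_cases hi : i ∈ S
    · rw [Set.indicator_of_mem hi]
      simp [h0 i hi]
    · rw [Set.indicator_of_notMem hi]
      by_cases hc : c i = 0
      · simp [hc]
      · have he := hpos i hi hc
        have h1 : Tendsto (fun ρ : ℝ => ρ ^ e i) (𝓝[>] 0) (𝓝 0) := by
          have := (Real.continuousAt_rpow_const 0 (e i) (Or.inr he.le)).tendsto
          rw [Real.zero_rpow he.ne'] at this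
          exact this.mono_left nhdsWithin_le_nhds
        have h2 := (Complex.continuous_ofReal.tendsto 0).comp h1
        simpa using h2.mul_const (c i)
  have hdom : ∀ᶠ ρ in 𝓝[>] (0 : ℝ), ∀ i,
      ‖((ρ ^ e i : ℝ) : ℂ) * c i‖ ≤ ‖((ρ₀ ^ e i : ℝ) : ℂ) * c i‖ := by
    filter_upwards [hev, hmem] with ρ hρ hρ' i
    by_cases hc : c i = 0
    · simp [hc]
    have he : 0 ≤ e i := by
      by_cases hi : i ∈ S
      · exact (h0 i hi).ge
      · exact (hpos i hi hc).le
    rw [norm_mul, norm_mul, Complex.norm_of_nonneg (Real.rpow_nonneg hρ.le _),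
      Complex.norm_of_nonneg (Real.rpow_nonneg hρ₀.le _)]
    gcongr
  have ht := tendsto_tsum_of_dominated_convergence hbound hlim hdom
  have ht' : Tendsto R (𝓝[>] 0) (𝓝 (∑' i, S.indicator c i)) := by
    refine ht.congr' ?_
    filter_upwards [hR] with ρ hρ using hρ.tsum_eq
  rw [tendsto_nhds_unique ha ht']
  refine (Summable.of_norm_bounded hbound fun i => ?_).hasSum
  refine le_of_tendsto (hlim i).norm ?_
  filter_upwards [hdom] with ρ hρ using hρ i

end

/-! ### The flow equation after shrinking the disk -/

noncomputable section

namespace ConformalFieldTheory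

variable {V : Type*} [AddCommGroup V] [Module ℂ V] {T : ConformalFieldTheory V}

/-- The integrand, at radius `s`, of the derivative of the annulus amplitudes: the weights of the
states on the two sides of the insertion of `v` are `q.1` (inside) and `q.2` (outside). -/
def flowDensity (T : ConformalFieldTheory V) (v : V) (U : ℕ → ℝ → V →ₗ[ℂ] T.Hat) (r : ℝ) (y : V)
    (ω : ℝ × ℝ) (φ : Module.Dual ℂ V) (i l : ℕ) (q : (ℝ × ℝ) × (ℝ × ℝ)) (s : ℝ) : ℂ :=
  if (q.2 - q.1).1 = (q.2 - q.1).2 then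
    (s : ℂ)⁻¹ * φ (U i s (T.mode v (q.2 - q.1) (U l (r / s) y q.1)) ω) else 0

/-- Isolates the dependence on ρ: the field inserted has total weight κ₁ + κ₂ + 2(1 - Δ), and the
density normalization removes a further ρ². -/
theorem insertion_eq_rpow_mul {Δ : ℝ} (Θ : Module.End ℂ V) (U : ℕ → ℝ → V →ₗ[ℂ] T.Hat)
    (f : ℕ → T.Hat) (r : ℝ) (y : V) (ω : ℝ × ℝ) (φ : Module.Dual ℂ V) {ρ : ℝ} (hρ : 0 < ρ)
    (i j l : ℕ) (κ β α : ℝ × ℝ) (x : ℂ) :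
    T.insertion Δ Θ U f r y ω φ ρ i j l κ β α x =
      ((ρ ^ (κ.1 + κ.2 - 2 * Δ) : ℝ) : ℂ) * T.insertion Δ Θ U f r y ω φ 1 i j l κ β α x := by
  simp only [insertion]
  rw [← mul_assoc, ← mul_assoc, ← Complex.ofReal_mul]
  congr 3
  rw [Real.div_rpow hρ.le (norm_nonneg x), Real.div_rpow zero_le_one (norm_nonneg x),
    show κ.1 + κ.2 + 2 * (1 - Δ) = (κ.1 + κ.2 - 2 * Δ) + (2 : ℕ) by push_cast; ring,
    Real.rpow_add_natCast hρ.ne']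
  simp
  field_simp

/-- The derivative of the annulus amplitudes, after the disk has been shrunk to a point and the
angular integral has been carried out. -/
theorem IsDeformation.hasSum_flowDensity {Δ : ℝ} {Θ : Module.End ℂ V} {u : V} {h : ℕ}
    {U : ℕ → ℝ → V →ₗ[ℂ] T.Hat} {f : ℕ → T.Hat} (D : T.IsDeformation Δ Θ u h U f)
    (hv : Θ u ∈ T.gr (1, 1)) (hf : ∀ k, 1 ≤ k → k < h → T.HasWeightGT Δ (f k)) {k : ℕ}
    (hk : k < h) {r : ℝ} (hr : r ∈ Set.Ioo (0 : ℝ) 1) {κ₀ : ℝ × ℝ} {y : V} (hy : y ∈ T.gr κ₀)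
    (ω : ℝ × ℝ) (φ : Module.Dual ℂ V) :
    HasSum (fun p : {p : ℕ × ℕ // p.1 + p.2 = k} × ((ℝ × ℝ) × (ℝ × ℝ)) =>
      ∫ s in Set.Ioo r 1, T.flowDensity (Θ u) U r y ω φ p.1.1.1 p.1.1.2 p.2 s)
      (((k : ℂ) + 1) * φ (U (k + 1) r y ω)) := by
  obtain ⟨R, hR, hlim⟩ := D.flow k hk r hr κ₀ y hy ω φ
  have hev : ∀ᶠ ρ in 𝓝[>] (0 : ℝ), 0 < ρ := self_mem_nhdsWithin
  have key := hasSum_of_tendsto_rpow (ι := {p : ℕ × ℕ × ℕ // p.1 + p.2.1 + p.2.2 = k} ×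
      (ℝ × ℝ) × (ℝ × ℝ) × (ℝ × ℝ)) (e := fun p => p.2.1.1 + p.2.1.2 - 2 * Δ)
    (c := fun p => ∫ x in annulus r, T.insertion Δ Θ U f r y ω φ 1
      p.1.1.1 p.1.1.2.1 p.1.1.2.2 p.2.1 p.2.2.1 p.2.2.2 x)
    (S := {p | p.1.1.2.1 = 0 ∧ p.2.1 = (Δ, Δ)}) (R := R) (by
      filter_upwards [hR, hev] with ρ hρ h0
      convert hρ.2 using 1
      funext p
      rw [← MeasureTheory.integral_const_mul]
      simp only [← insertion_eq_rpow_mul Θ U f r y ω φ h0]) hlim (by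
      rintro p ⟨-, hp⟩
      simp only [hp]
      ring) (by
      rintro ⟨⟨⟨i, j, l⟩, hp⟩, κ, β, α⟩ hS hc
      simp only [Set.mem_ofPred_eq, not_and] at hS hp
      -- A surviving term either has j = 0, where the field is concentrated in weight (Δ,Δ), or
      -- comes from a correction of weight above (Δ,Δ), where the exponent is positive.
      have hne : f j κ ≠ 0 := fun h0 => hc (by simp [insertion, h0])
      rcases Nat.eq_zero_or_pos j with rfl | hj
      · exact absurd (D.field_zero.2 κ (hS rfl)) hne
      · have := hf j hj (by omega) κ hne
        simp only
        linarith [this.1, this.2])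
  -- Identifies the index set of the limit with the ρ-independent terms.
  let g : {p : ℕ × ℕ // p.1 + p.2 = k} × ((ℝ × ℝ) × (ℝ × ℝ)) →
      {p : ℕ × ℕ × ℕ // p.1 + p.2.1 + p.2.2 = k} × (ℝ × ℝ) × (ℝ × ℝ) × (ℝ × ℝ) :=
    fun p => (⟨(p.1.1.1, 0, p.1.1.2), by simpa using p.1.2⟩, (Δ, Δ), p.2.1, p.2.2)
  have hg : Function.Injective g := by
    rintro ⟨⟨⟨i, l⟩, _⟩, β, α⟩ ⟨⟨⟨i', l'⟩, _⟩, β', α'⟩ hpq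
    simp only [g, Prod.mk.injEq, Subtype.mk.injEq, true_and] at hpq ⊢
    tauto
  have key' := (hg.hasSum_iff (by
    rintro ⟨⟨⟨i, j, l⟩, hp⟩, κ, β, α⟩ hx
    refine Set.indicator_of_notMem ?_ _
    rintro ⟨hj, hκ⟩
    simp only at hj hκ
    subst hj hκ
    exact hx ⟨(⟨(i, l), by simpa using hp⟩, β, α), rfl⟩)).2 key
  convert key' using 1
  funext p
  obtain ⟨⟨⟨i, l⟩, hp⟩, β, α⟩ := p
  symm
  rw [Function.comp_apply, Set.indicator_of_mem (show g (⟨(i, l), hp⟩, β, α) ∈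
    {p | (p.1.1.2.1 = 0 ∧ p.2.1 = (Δ, Δ))} from ⟨rfl, rfl⟩)]
  simp only [g, insertion, D.field_zero.1]
  -- Single-valuedness gives an integral spin only for nonzero modes; for a zero mode both sides
  -- vanish.
  by_cases hm : T.mode (Θ u) (α - β) = 0
  · simp [hm, flowDensity]
  obtain ⟨n, hn⟩ := T.mode_single_valued (1, 1) (Θ u) hv (α - β) hm
  have hn' : (α - β - ((Δ, Δ) + (1 - Δ, 1 - Δ))).1 - (α - β - ((Δ, Δ) + (1 - Δ, 1 - Δ))).2 = n := by
    rw [← hn]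
    simp
  have h2 : ∀ x : ℂ, (((2 * Real.pi)⁻¹ * ((1 : ℝ) ^ 2)⁻¹ *
      (1 / ‖x‖) ^ (Δ + Δ + 2 * (1 - Δ)) : ℝ) : ℂ) *
      zpair (x / (‖x‖ : ℂ)) (α - β - ((Δ, Δ) + (1 - Δ, 1 - Δ))) *
      φ (U i ‖x‖ (T.mode (Θ u) (α - β) (U l (r / ‖x‖) y β)) ω) =
      zpair (x / (‖x‖ : ℂ)) (α - β - ((Δ, Δ) + (1 - Δ, 1 - Δ))) *
      (fun s : ℝ => (((2 * Real.pi)⁻¹ * (s ^ 2)⁻¹ : ℝ) : ℂ) *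
        φ (U i s (T.mode (Θ u) (α - β) (U l (r / s) y β)) ω)) ‖x‖ := by
    intro x
    rw [show Δ + Δ + 2 * (1 - Δ) = ((2 : ℕ) : ℝ) by push_cast; ring, Real.rpow_natCast]
    simp
    ring
  simp only [h2]
  have h4 := integral_annulus hr.1 (fun s : ℝ => (((2 * Real.pi)⁻¹ * (s ^ 2)⁻¹ : ℝ) : ℂ) *
    φ (U i s (T.mode (Θ u) (α - β) (U l (r / s) y β)) ω)) hn'
  rw [h4]
  have h3 : (α - β - ((Δ, Δ) + (1 - Δ, 1 - Δ))).1 = (α - β - ((Δ, Δ) + (1 - Δ, 1 - Δ))).2 ↔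
      (α - β).1 = (α - β).2 := by
    simp
  simp only [flowDensity, h3]
  split_ifs
  · rw [← MeasureTheory.integral_const_mul]
    refine setIntegral_congr_fun measurableSet_Ioo fun s hs => ?_
    have hs0 : (s : ℂ) ≠ 0 := Complex.ofReal_ne_zero.2 (hr.1.trans hs.1).ne'
    have hpi : (Real.pi : ℂ) ≠ 0 := Complex.ofReal_ne_zero.2 Real.pi_ne_zero
    push_cast
    field_simp
  · simp

end ConformalFieldTheory

end

noncomputable section

/-! ### Time ordered series for the annuli -/

section Tuples

/-- Appending the middle entry to the first tuple. -/
def tripleSnoc (l i : ℕ) : (Fin l → ℝ) × ℝ × (Fin i → ℝ) ≃ (Fin (l + 1) → ℝ) × (Fin i → ℝ) where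
  toFun p := (Fin.snoc p.1 p.2.1, p.2.2)
  invFun p := (Fin.init p.1, p.1 (Fin.last l), p.2)
  left_inv p := by simp
  right_inv p := by simp

/-- Prepending the middle entry to the second tuple. -/
def tripleCons (l i : ℕ) : (Fin l → ℝ) × ℝ × (Fin i → ℝ) ≃ (Fin l → ℝ) × (Fin (i + 1) → ℝ) where
  toFun p := (p.1, Fin.cons p.2.1 p.2.2)
  invFun p := (p.1, p.2 0, Fin.tail p.2)
  left_inv p := by simp
  right_inv p := by simp

theorem hasSum_tripleSnoc_iff {l i : ℕ} {F : (Fin (l + 1) → ℝ) × (Fin i → ℝ) → ℂ} {S : ℂ} :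
    HasSum (fun p : (Fin l → ℝ) × ℝ × (Fin i → ℝ) => F (Fin.snoc p.1 p.2.1, p.2.2)) S ↔
      HasSum F S :=
  (tripleSnoc l i).hasSum_iff (f := F)

theorem hasSum_tripleCons_iff {l i : ℕ} {F : (Fin l → ℝ) × (Fin (i + 1) → ℝ) → ℂ} {S : ℂ} :
    HasSum (fun p : (Fin l → ℝ) × ℝ × (Fin i → ℝ) => F (p.1, Fin.cons p.2.1 p.2.2)) S ↔
      HasSum F S :=
  (tripleCons l i).hasSum_iff (f := F)

theorem sum_snoc {l : ℕ} (a : Fin l → ℝ) (t : ℝ) :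
    ∑ j, (Fin.snoc a t : Fin (l + 1) → ℝ) j = ∑ j, a j + t := by
  simp [Fin.sum_univ_castSucc]

theorem sum_cons {l : ℕ} (t : ℝ) (b : Fin l → ℝ) :
    ∑ j, (Fin.cons t b : Fin (l + 1) → ℝ) j = t + ∑ j, b j := by
  simp [Fin.sum_univ_succ]

/-- A time ordered sum over `k` tuples may be split into a sum over pairs of tuples. -/
theorem HasSum.timeOrdered_split {r : ℝ} {Ψ : (l i : ℕ) → (Fin l → ℝ) → (Fin i → ℝ) → ℂ}
    (hΨ : ∀ l i a t b, Ψ (l + 1) i (Fin.snoc a t) b = Ψ l (i + 1) a (Fin.cons t b)) {k : ℕ} {S : ℂ}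
    (hS : HasSum (fun m : Fin k → ℝ => (timeOrdered r k m 1 : ℂ) * Ψ k 0 m Fin.elim0) S) (i l : ℕ)
    (hli : l + i = k) :
    HasSum (fun p : (Fin l → ℝ) × (Fin i → ℝ) =>
      (orderedIntegral r (timeOrdered r l p.1) i p.2 1 : ℂ) * Ψ l i p.1 p.2) S := by
  induction i generalizing l with
  | zero =>
    obtain rfl : l = k := hli
    rw [← (Equiv.prodUnique (Fin l → ℝ) (Fin 0 → ℝ)).symm.hasSum_iff]
    convert hS using 2 with m
    simp only [Function.comp_apply, Equiv.prodUnique_symm_apply, orderedIntegral]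
    congr 2
  | succ i ih =>
    rw [← hasSum_tripleCons_iff]
    have := hasSum_tripleSnoc_iff.2 (ih (l + 1) (by omega))
    convert this using 2 with p
    simp only [hΨ, orderedIntegral_timeOrdered_cons]

end Tuples

namespace ConformalFieldTheory

variable {V : Type*} [AddCommGroup V] [Module ℂ V] {T : ConformalFieldTheory V}

theorem modeProd_cons (v : V) (k : ℕ) (t : ℝ) (m : Fin k → ℝ) :
    T.modeProd v (k + 1) (Fin.cons t m) = T.modeProd v k m * T.mode v (t, t) := by
  induction k with
  | zero => simp [modeProd]
  | succ k ih =>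
    have h : (fun i : Fin (k + 1) => (Fin.cons t m : Fin (k + 2) → ℝ) i.castSucc) =
        Fin.cons t (fun i => m i.castSucc) := by
      funext i
      refine Fin.cases rfl (fun i => ?_) i
      rfl
    rw [modeProd, h, ih, modeProd, mul_assoc]
    rfl

theorem modeProd_snoc (v : V) (k : ℕ) (m : Fin k → ℝ) (t : ℝ) :
    T.modeProd v (k + 1) (Fin.snoc m t) = T.mode v (t, t) * T.modeProd v k m := by
  simp [modeProd]

theorem modeProd_mem (v : V) {κ : ℝ × ℝ} {y : V} (hy : y ∈ T.gr κ) (k : ℕ) (m : Fin k → ℝ) :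
    T.modeProd v k m y ∈ T.gr (κ + (∑ i, m i, ∑ i, m i)) := by
  induction k with
  | zero => simpa [modeProd, ← Prod.zero_eq_mk] using hy
  | succ k ih =>
    have h := T.mode_mem v (m (Fin.last k), m (Fin.last k)) _ _ (ih fun i => m i.castSucc)
    rw [modeProd, Module.End.mul_apply]
    convert h using 2
    ext <;> simp [Fin.sum_univ_castSucc, add_assoc]

/-- The matrix elements of products of modes, restricted to a given total weight. -/
def modeCoeff (T : ConformalFieldTheory V) (v : V) (κ : ℝ × ℝ) (y : V) (ω : ℝ × ℝ)
    (φ : Module.Dual ℂ V) (l i : ℕ) (a : Fin l → ℝ) (b : Fin i → ℝ) : ℂ :=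
  if κ + (∑ j, a j + ∑ j, b j, ∑ j, a j + ∑ j, b j) = ω then
    φ (T.modeProd v i b (T.modeProd v l a y)) else 0

/-- The coefficient depends only on the concatenation of the two tuples, as
`HasSum.timeOrdered_split` requires. -/
theorem modeCoeff_snoc (v : V) (κ : ℝ × ℝ) (y : V) (ω : ℝ × ℝ)
    (φ : Module.Dual ℂ V) (l i : ℕ) (a : Fin l → ℝ) (t : ℝ) (b : Fin i → ℝ) :
    T.modeCoeff v κ y ω φ (l + 1) i (Fin.snoc a t) b =
      T.modeCoeff v κ y ω φ l (i + 1) a (Fin.cons t b) := by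
  simp only [modeCoeff, modeProd_cons, modeProd_snoc, sum_snoc, sum_cons, Module.End.mul_apply,
    add_assoc]

/-- At a fixed radius and fixed intermediate weights, summing over the second tuple gives the series
for `U i s`, and then summing over the first gives the series for `U l (r / s)`. The joint
summability needed for this iterated summation is assumed here; Fubini supplies it for almost every
radius. -/
theorem hasSum_flowDensity_fiber {v : V} {U : ℕ → ℝ → V →ₗ[ℂ] T.Hat} {i l : ℕ} {r s : ℝ}
    (hr : 0 < r) (hs : r < s)
    {κ : ℝ × ℝ} {y : V} (hy : y ∈ T.gr κ)
    (hi : ∀ κ', ∀ y' ∈ T.gr κ', T.IsTimeOrderedSeries v i s κ' y' (U i s y'))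
    (hl : T.IsTimeOrderedSeries v l (r / s) κ y (U l (r / s) y)) (ω : ℝ × ℝ)
    (φ : Module.Dual ℂ V)
    (hsum : Summable fun p : (Fin l → ℝ) × ℝ × (Fin i → ℝ) =>
      ((s ^ (2 * p.2.1 - 1) * timeOrdered r l p.1 s * timeOrdered s i p.2.2 1 : ℝ) : ℂ) *
        (((r ^ (κ.1 + κ.2) : ℝ) : ℂ) *
          T.modeCoeff v κ y ω φ (l + 1) i (Fin.snoc p.1 p.2.1) p.2.2))
    (q : (ℝ × ℝ) × (ℝ × ℝ)) :
    HasSum (((fun p : (Fin l → ℝ) × ℝ × (Fin i → ℝ) =>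
      (κ + (∑ j, p.1 j, ∑ j, p.1 j), κ + (∑ j, p.1 j + p.2.1, ∑ j, p.1 j + p.2.1))) ⁻¹'
        {q}).indicator fun p : (Fin l → ℝ) × ℝ × (Fin i → ℝ) =>
      ((s ^ (2 * p.2.1 - 1) * timeOrdered r l p.1 s * timeOrdered s i p.2.2 1 : ℝ) : ℂ) *
        (((r ^ (κ.1 + κ.2) : ℝ) : ℂ) *
          T.modeCoeff v κ y ω φ (l + 1) i (Fin.snoc p.1 p.2.1) p.2.2))
      (T.flowDensity v U r y ω φ i l q s) := by
  obtain ⟨β, α⟩ := q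
  have hs0 : 0 < s := hr.trans hs
  by_cases hdiag : (α - β).1 = (α - β).2
  swap
  · rw [flowDensity, if_neg hdiag]
    convert hasSum_zero using 1
    funext p
    refine Set.indicator_of_notMem (fun hp => hdiag ?_) _
    simp only [Set.mem_preimage, Set.mem_singleton_iff, Prod.mk.injEq] at hp
    rw [← hp.1, ← hp.2]
    simp
  obtain ⟨τ, rfl⟩ : ∃ τ, α = β + (τ, τ) := by
    refine ⟨(α - β).1, ?_⟩
    ext
    · simp
    · simp [hdiag]
  have hαβ : β + (τ, τ) - β = (τ, τ) := by simp
  rw [flowDensity, if_pos hdiag, hαβ]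
  have hfib : ∀ (a : Fin l → ℝ) (t : ℝ), (κ + (∑ j, a j, ∑ j, a j) = β ∧
      κ + (∑ j, a j + t, ∑ j, a j + t) = β + (τ, τ)) ↔
      κ + (∑ j, a j, ∑ j, a j) = β ∧ t = τ := by
    intro a t
    refine and_congr_right fun h => ?_
    rw [← h, add_assoc, add_right_inj, Prod.ext_iff]
    simp
  let G : (Fin l → ℝ) × (Fin i → ℝ) → ℂ := fun p =>
    if κ + (∑ j, p.1 j, ∑ j, p.1 j) = β then
      ((s ^ (2 * τ - 1) * timeOrdered r l p.1 s * timeOrdered s i p.2 1 : ℝ) : ℂ) *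
        (((r ^ (κ.1 + κ.2) : ℝ) : ℂ) *
          T.modeCoeff v κ y ω φ (l + 1) i (Fin.snoc p.1 τ) p.2) else 0
  have hinj : Function.Injective fun p : (Fin l → ℝ) × (Fin i → ℝ) => (p.1, τ, p.2) := by
    rintro ⟨a, b⟩ ⟨a', b'⟩ h
    simpa using h
  have hG : Summable G := by
    have h1 := (hsum.indicator {p | κ + (∑ j, p.1 j, ∑ j, p.1 j) = β}).comp_injective hinj
    refine h1.congr fun p => ?_
    simp only [G, Function.comp_apply, Set.indicator, Set.mem_ofPred_eq]
  suffices h : HasSum G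
      ((s : ℂ)⁻¹ * φ (U i s (T.mode v (τ, τ) (U l (r / s) y β)) ω)) by
    rw [← hinj.hasSum_iff]
    · convert h using 1
      funext p
      simp only [G, Function.comp_apply, Set.indicator, Set.mem_preimage, Set.mem_singleton_iff,
        Prod.mk.injEq, hfib, and_true]
    · rintro ⟨a, t, b⟩ hx
      refine Set.indicator_of_notMem (fun hp => hx ?_) _
      simp only [Set.mem_preimage, Set.mem_singleton_iff, Prod.mk.injEq, hfib] at hp
      exact ⟨(a, b), by simp [hp.2]⟩
  -- Convergence is tested on all linear functionals, hence also on this one; that replaces any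
  -- continuity of the outer annulus and of the mode.
  let ψ : Module.Dual ℂ V := φ ∘ₗ (T.gr ω).subtype ∘ₗ LinearMap.proj ω ∘ₗ U i s ∘ₗ T.mode v (τ, τ)
  have hψ : ∀ z, ψ z = φ (U i s (T.mode v (τ, τ) z) ω) := fun z => rfl
  have houter := (hl β ψ).mul_left (s : ℂ)⁻¹
  rw [← hψ]
  have hfiber := hG.hasSum.prod_fiberwise (g := fun a => (s : ℂ)⁻¹ *
    ψ (Set.indicator {m : Fin l → ℝ | κ + (∑ i, m i, ∑ i, m i) = β}
      (fun m => (timeOrdered (r / s) l m 1 : ℂ) •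
        T.modeProd v l m ((((r / s) ^ (κ.1 + κ.2) : ℝ) : ℂ) • y)) a)) fun a => by
    by_cases ha : κ + (∑ j, a j, ∑ j, a j) = β
    swap
    · simp [G, ha]
    have hz : T.mode v (τ, τ) (T.modeProd v l a y) ∈ T.gr (β + (τ, τ)) :=
      T.mode_mem v (τ, τ) β _ (ha ▸ modeProd_mem v hy l a)
    have hin := (hi _ _ hz ω φ).mul_left
      ((s : ℂ)⁻¹ * (timeOrdered (r / s) l a 1 * ((r / s) ^ (κ.1 + κ.2) : ℝ)))
    refine hin.of_eq (fun b => ?_) ?_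
    · have hcond : κ + (∑ j, (Fin.snoc a τ : Fin (l + 1) → ℝ) j + ∑ j, b j,
          ∑ j, (Fin.snoc a τ : Fin (l + 1) → ℝ) j + ∑ j, b j) =
          β + (τ, τ) + (∑ j, b j, ∑ j, b j) := by
        rw [← ha, sum_snoc]
        ext <;> simp [add_assoc]
      simp only [G, ha, if_true, modeCoeff, hcond, Set.indicator, Set.mem_ofPred_eq]
      split_ifs with hω
      swap
      · simp
      have hto : timeOrdered r l a s = s ^ (2 * ∑ j, a j) * timeOrdered (r / s) l a 1 := by
        have := timeOrdered_mul hs0 (div_pos hr hs0) one_pos l a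
        rwa [mul_div_cancel₀ _ hs0.ne', mul_one] at this
      -- The powers of `s` match: ds/s from the measure, (r/s)^(κ₁+κ₂) from the inner annulus, and
      -- the weight of the state entering the outer one.
      have hpow : s ^ (2 * τ - 1) * s ^ (2 * ∑ j, a j) * r ^ (κ.1 + κ.2) =
          s⁻¹ * (r / s) ^ (κ.1 + κ.2) * s ^ ((β + (τ, τ)).1 + (β + (τ, τ)).2) := by
        have h1 : s ^ (2 * τ - 1) * s ^ (2 * ∑ j, a j) =
            s ^ (-1 : ℝ) * s ^ (-(κ.1 + κ.2)) * s ^ ((β + (τ, τ)).1 + (β + (τ, τ)).2) := by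
          rw [← ha, ← Real.rpow_add hs0, ← Real.rpow_add hs0, ← Real.rpow_add hs0]
          congr 1
          simp only [Prod.fst_add, Prod.snd_add]
          ring
        rw [h1, Real.div_rpow hr.le hs0.le, ← Real.rpow_neg_one s, Real.rpow_neg hs0.le (κ.1 + κ.2)]
        ring
      rw [hto, modeProd_snoc, Module.End.mul_apply]
      simp only [map_smul, smul_eq_mul]
      have hpow' : ((s ^ (2 * τ - 1) : ℝ) : ℂ) * ((s ^ (2 * ∑ j, a j) : ℝ) : ℂ) *
          ((r ^ (κ.1 + κ.2) : ℝ) : ℂ) = (s : ℂ)⁻¹ * (((r / s) ^ (κ.1 + κ.2) : ℝ) : ℂ) *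
          ((s ^ ((β + (τ, τ)).1 + (β + (τ, τ)).2) : ℝ) : ℂ) := by
        rw [← Complex.ofReal_inv]
        exact_mod_cast hpow
      simp only [Complex.ofReal_mul]
      linear_combination ((timeOrdered (r / s) l a 1 : ℂ) * (timeOrdered s i b 1 : ℂ) *
        φ (T.modeProd v i b (T.mode v (τ, τ) (T.modeProd v l a y)))) * hpow'
    · simp only [Set.indicator, Set.mem_ofPred_eq, ha, if_true, map_smul, smul_eq_mul]
      rw [hψ]
      ring
  exact houter.unique hfiber ▸ hG.hasSum

end ConformalFieldTheory

end

/-! ### Part (a): induction on the order of the annulus amplitudes -/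

noncomputable section

namespace ConformalFieldTheory

variable {V : Type*} [AddCommGroup V] [Module ℂ V] {T : ConformalFieldTheory V}

theorem modeCoeff_zero_right (v : V) (κ : ℝ × ℝ) (y : V) (ω : ℝ × ℝ) (φ : Module.Dual ℂ V)
    (k : ℕ) (m : Fin k → ℝ) : T.modeCoeff v κ y ω φ k 0 m Fin.elim0 =
      if κ + (∑ i, m i, ∑ i, m i) = ω then φ (T.modeProd v k m y) else 0 := by
  simp [modeCoeff, modeProd]

theorem ModeSeriesConverge.summable_timeOrdered {v u : V} {h : ℕ}
    (hc : T.ModeSeriesConverge v u h) {k : ℕ} (hk : k ≤ h) {r : ℝ} (hr : r ∈ Set.Ioo (0 : ℝ) 1)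
    (κ : ℝ × ℝ) (y : V) (ω : ℝ × ℝ) (φ : Module.Dual ℂ V) :
    Summable fun m : Fin k → ℝ => (timeOrdered r k m 1 : ℂ) *
      T.modeCoeff v κ y ω φ k 0 m Fin.elim0 := by
  simp only [modeCoeff_zero_right]
  by_cases hM : ∃ M : ℝ, κ + (M, M) = ω
  · obtain ⟨M, rfl⟩ := hM
    obtain ⟨x, hx⟩ := hc.annulus k hk r hr y M
    refine (hx φ).summable.congr fun m => ?_
    have : κ + (∑ i, m i, ∑ i, m i) = κ + (M, M) ↔ ∑ i, m i = M := by
      rw [add_right_inj, Prod.ext_iff]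
      simp
    simp only [Set.indicator, Set.mem_ofPred_eq, this]
    split_ifs <;> simp
  · refine summable_zero.congr fun m => ?_
    rw [if_neg fun h => hM ⟨_, h⟩, mul_zero]

theorem isTimeOrderedSeries_iff {v : V} {k : ℕ} {r : ℝ} {κ : ℝ × ℝ} {y : V} {x : T.Hat} :
    T.IsTimeOrderedSeries v k r κ y x ↔ ∀ (ω : ℝ × ℝ) (φ : Module.Dual ℂ V),
      HasSum (fun m : Fin k → ℝ => (timeOrdered r k m 1 : ℂ) *
        (((r ^ (κ.1 + κ.2) : ℝ) : ℂ) * T.modeCoeff v κ y ω φ k 0 m Fin.elim0)) (φ (x ω)) := by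
  refine forall_congr' fun ω => forall_congr' fun φ => ?_
  have : (fun m : Fin k → ℝ => φ (Set.indicator {m : Fin k → ℝ | κ + (∑ i, m i, ∑ i, m i) = ω}
      (fun m => (timeOrdered r k m 1 : ℂ) •
        T.modeProd v k m (((r ^ (κ.1 + κ.2) : ℝ) : ℂ) • y)) m)) =
      fun m : Fin k → ℝ => (timeOrdered r k m 1 : ℂ) *
        (((r ^ (κ.1 + κ.2) : ℝ) : ℂ) * T.modeCoeff v κ y ω φ k 0 m Fin.elim0) := by
    funext m
    simp only [Set.indicator, Set.mem_ofPred_eq, modeCoeff_zero_right]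
    split_ifs <;> simp
  rw [this]

/-- Integrating the product of two time ordered series over the position of the insertion. -/
theorem hasSum_integral_flowDensity {v : V} {U : ℕ → ℝ → V →ₗ[ℂ] T.Hat} {i l : ℕ}
    (hi : ∀ s ∈ Set.Ioo (0 : ℝ) 1, ∀ κ, ∀ y ∈ T.gr κ, T.IsTimeOrderedSeries v i s κ y (U i s y))
    (hl : ∀ s ∈ Set.Ioo (0 : ℝ) 1, ∀ κ, ∀ y ∈ T.gr κ, T.IsTimeOrderedSeries v l s κ y (U l s y))
    {r : ℝ} (hr : r ∈ Set.Ioo (0 : ℝ) 1) {κ : ℝ × ℝ} {y : V} (hy : y ∈ T.gr κ)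
    (ω : ℝ × ℝ) (φ : Module.Dual ℂ V) {S : ℂ}
    (hS : HasSum (fun p : (Fin (l + 1) → ℝ) × (Fin i → ℝ) =>
      (orderedIntegral r (timeOrdered r (l + 1) p.1) i p.2 1 : ℂ) *
        (((r ^ (κ.1 + κ.2) : ℝ) : ℂ) * T.modeCoeff v κ y ω φ (l + 1) i p.1 p.2)) S) :
    HasSum (fun q => ∫ s in Set.Ioo r 1, T.flowDensity v U r y ω φ i l q s) S := by
  rw [← hasSum_tripleSnoc_iff] at hS
  refine hasSum_integral_fiberwise (w := fun (p : (Fin l → ℝ) × ℝ × (Fin i → ℝ)) s =>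
    s ^ (2 * p.2.1 - 1) * timeOrdered r l p.1 s * timeOrdered s i p.2.2 1)
    (fun p => ?_) (fun p => ?_) (fun p => ?_) (fun p => ?_) hS
    (fun p => (κ + (∑ j, p.1 j, ∑ j, p.1 j), κ + (∑ j, p.1 j + p.2.1, ∑ j, p.1 j + p.2.1))) ?_
  · have hc : ContinuousOn (fun s : ℝ => s ^ (2 * p.2.1 - 1) * timeOrdered r l p.1 s *
        timeOrdered s i p.2.2 1) (Set.Ioi 0) := by
      refine ((continuousOn_rpow_Ioi _).mul (continuousOn_timeOrdered hr.1 l _)).mul ?_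
      exact (continuousOn_timeOrdered_uncurry i p.2.2).comp
        (continuousOn_id.prodMk continuousOn_const) fun s hs => ⟨hs, Set.mem_Ioi.2 one_pos⟩
    have := (hc.intervalIntegrable_Ioi hr.1 one_pos).1
    exact this.mono_set Set.Ioo_subset_Ioc_self
  · refine ae_restrict_of_forall_mem measurableSet_Ioo fun s hs => ?_
    have hs0 : 0 < s := hr.1.trans hs.1
    exact (mul_pos (mul_pos (Real.rpow_pos_of_pos hs0 _) (timeOrdered_pos hr.1 hs.1 _ _))
      (timeOrdered_pos hs0 hs.2 _ _)).le
  · rw [← integral_Ioc_eq_integral_Ioo, ← intervalIntegral.integral_of_le hr.2.le,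
      integral_timeOrdered_mul_timeOrdered hr.1 hr.2.le, orderedIntegral_timeOrdered_cons]
  · exact orderedIntegral_pos hr.1 hr.2 (continuousOn_timeOrdered hr.1 _ _)
      (fun s hs => timeOrdered_pos hr.1 hs _ _) _ _
  · refine ae_restrict_of_forall_mem measurableSet_Ioo fun s hs q hsum => ?_
    have hs0 : 0 < s := hr.1.trans hs.1
    exact hasSum_flowDensity_fiber hr.1 hs.1 hy (hi s ⟨hs0, hs.2⟩)
      (hl (r / s) ⟨div_pos hr.1 hs0, (div_lt_one hs0).2 hs.1⟩ κ y hy) ω φ hsum q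

/-- The annulus amplitudes of a deformation are given by time ordered integrals. -/
theorem IsDeformation.isTimeOrderedSeries {Δ : ℝ} {Θ : Module.End ℂ V} {u : V} {h : ℕ}
    {U : ℕ → ℝ → V →ₗ[ℂ] T.Hat} {f : ℕ → T.Hat} (D : T.IsDeformation Δ Θ u h U f)
    (hv : Θ u ∈ T.gr (1, 1)) (hf : ∀ k, 1 ≤ k → k < h → T.HasWeightGT Δ (f k))
    (hc : T.ModeSeriesConverge (Θ u) u h) (n : ℕ) (hn : n ≤ h) :
    ∀ r ∈ Set.Ioo (0 : ℝ) 1, ∀ κ, ∀ y ∈ T.gr κ,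
      T.IsTimeOrderedSeries (Θ u) n r κ y (U n r y) := by
  induction n using Nat.strong_induction_on with
  | _ n ih =>
  intro r hr κ y hy
  rw [isTimeOrderedSeries_iff]
  intro ω φ
  cases n with
  | zero =>
    obtain ⟨h1, h2⟩ := D.annulus_zero r hr κ y hy
    refine (hasSum_unique _).of_eq (fun _ => rfl) ?_
    rw [modeCoeff_zero_right]
    by_cases hω : ω = κ
    · subst hω
      simp [h1, timeOrdered, modeProd, ← Prod.zero_eq_mk]
    · simp [h2 ω hω, ← Prod.zero_eq_mk, Ne.symm hω]
  | succ n =>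
    have hsum := (hc.summable_timeOrdered hn hr κ y ω φ).mul_left ((r ^ (κ.1 + κ.2) : ℝ) : ℂ)
    obtain ⟨S, hS⟩ := hsum
    have hS' : HasSum (fun m : Fin (n + 1) → ℝ => (timeOrdered r (n + 1) m 1 : ℂ) *
        (((r ^ (κ.1 + κ.2) : ℝ) : ℂ) *
          T.modeCoeff (Θ u) κ y ω φ (n + 1) 0 m Fin.elim0)) S :=
      hS.of_eq (fun m => mul_left_comm _ _ _) rfl
    -- The convergence hypothesis provides the sum `S` of the series; only its identification with
    -- the amplitude is left.
    suffices hφ : φ (U (n + 1) r y ω) = S by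
      rw [hφ]
      exact hS'
    have hflow := D.hasSum_flowDensity hv hf (Nat.lt_of_succ_le hn) hr hy ω φ
    -- Every cut i + l = n contributes the same value `S`; the insertion itself is attached to the
    -- inner group, whence l + 1.
    have hfib := hflow.prod_fiberwise (g := fun _ => S) fun p => by
      obtain ⟨⟨i, l⟩, hp⟩ := p
      simp only at hp
      refine hasSum_integral_flowDensity (ih i (by omega) (by omega)) (ih l (by omega) (by omega))
        hr hy ω φ ?_
      exact HasSum.timeOrdered_split (Ψ := fun l i a b => ((r ^ (κ.1 + κ.2) : ℝ) : ℂ) *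
        T.modeCoeff (Θ u) κ y ω φ l i a b) (fun l i a t b => by rw [modeCoeff_snoc])
        hS' i (l + 1) (by omega)
    let e : {p : ℕ × ℕ // p.1 + p.2 = n} ≃ Finset.HasAntidiagonal.antidiagonal n :=
      Equiv.subtypeEquivRight fun p => Finset.HasAntidiagonal.mem_antidiagonal.symm
    rw [← e.symm.hasSum_iff] at hfib
    have h1 := hfib.unique (hasSum_fintype _)
    simp only [Function.comp_apply, Finset.sum_const, Finset.card_univ, Fintype.card_coe,
      Finset.Nat.card_antidiagonal, nsmul_eq_mul, Nat.cast_add, Nat.cast_one] at h1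
    exact mul_left_cancel₀ (by exact_mod_cast Nat.succ_ne_zero n) h1

end ConformalFieldTheory

end

noncomputable section

/-! ### Partial sums and the telescoping of the composite series -/

section PartialSums

theorem partialSum_snoc_castSucc {k : ℕ} (a : Fin k → ℝ) (t : ℝ) (j : Fin k) :
    partialSum (Fin.snoc a t : Fin (k + 1) → ℝ) j.castSucc = partialSum a j := by
  rw [partialSum, partialSum, ← Fin.map_castSuccEmb_Iic, Finset.sum_map]
  simp

theorem partialSum_last {k : ℕ} (m : Fin (k + 1) → ℝ) :
    partialSum m (Fin.last k) = ∑ i, m i := by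
  rw [partialSum]
  congr 1
  ext i
  simp [Fin.le_last]

theorem partialSum_snoc_last {k : ℕ} (a : Fin k → ℝ) (t : ℝ) :
    partialSum (Fin.snoc a t : Fin (k + 1) → ℝ) (Fin.last k) = ∑ i, a i + t := by
  rw [partialSum_last, sum_snoc]

theorem forall_partialSum_snoc {k : ℕ} (a : Fin k → ℝ) (t : ℝ) :
    (∀ j, partialSum (Fin.snoc a t : Fin (k + 1) → ℝ) j ≠ 0) ↔
      (∀ j, partialSum a j ≠ 0) ∧ ∑ i, a i + t ≠ 0 := by
  simp only [Fin.forall_fin_succ', partialSum_snoc_castSucc, partialSum_snoc_last]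

theorem forall_lt_partialSum_snoc {k : ℕ} (a : Fin k → ℝ) (t : ℝ) :
    (∀ j : Fin (k + 1), (j : ℕ) + 1 < k + 1 →
      partialSum (Fin.snoc a t : Fin (k + 1) → ℝ) j ≠ 0) ↔ ∀ j, partialSum a j ≠ 0 := by
  simp [Fin.forall_fin_succ', partialSum_snoc_castSucc]

theorem prod_partialSum_snoc {k : ℕ} (a : Fin k → ℝ) (t : ℝ) :
    ∏ j, partialSum (Fin.snoc a t : Fin (k + 1) → ℝ) j =
      (∏ j, partialSum a j) * (∑ i, a i + t) := by
  simp only [Fin.prod_univ_castSucc, partialSum_snoc_castSucc, partialSum_snoc_last]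

theorem prod_filter_partialSum_snoc {k : ℕ} (a : Fin k → ℝ) (t : ℝ) :
    ∏ j ∈ Finset.univ.filter (fun j : Fin (k + 1) => (j : ℕ) + 1 < k + 1),
      partialSum (Fin.snoc a t : Fin (k + 1) → ℝ) j = ∏ j, partialSum a j := by
  rw [Finset.prod_filter, Fin.prod_univ_castSucc]
  simp [partialSum_snoc_castSucc]

theorem sum_ne_zero_of_partialSum_ne_zero {k : ℕ} {m : Fin (k + 1) → ℝ}
    (h : ∀ j, partialSum m j ≠ 0) : ∑ i, m i ≠ 0 := by
  rw [← partialSum_last]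
  exact h _

/-- The summands of the series for the `k`-th correction, with `Ψ` in place of the product of
modes. -/
def correctionTerm (M : ℝ) (k : ℕ) (Ψ : (Fin k → ℝ) → ℂ) (m : Fin k → ℝ) : ℂ :=
  open Classical in
  if (∀ j, partialSum m j ≠ 0) ∧ ∑ i, m i = M then
    (((2 ^ k * ∏ j, partialSum m j)⁻¹ : ℝ) : ℂ) * Ψ m else 0

/-- The summands of the obstruction, with `Ψ` in place of the product of modes. -/
def obstructionTerm (k : ℕ) (Ψ : (Fin k → ℝ) → ℂ) (m : Fin k → ℝ) : ℂ :=
  open Classical in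
  if (∀ j : Fin k, (j : ℕ) + 1 < k → partialSum m j ≠ 0) ∧ ∑ i, m i = 0 then
    (((2 ^ k * ∏ j ∈ Finset.univ.filter (fun j : Fin k => (j : ℕ) + 1 < k),
      partialSum m j)⁻¹ : ℝ) : ℂ) * Ψ m else 0

/-- The summands of the composite of the series for an annulus, with weights `W`, and the series
for a correction. -/
def compositeTerm (M : ℝ) (k l : ℕ) (W : (Fin k → ℝ) → (Fin l → ℝ) → ℝ)
    (Ψ : (Fin k → ℝ) → (Fin l → ℝ) → ℂ) (p : (Fin k → ℝ) × (Fin l → ℝ)) : ℂ :=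
  open Classical in
  if (∀ j, partialSum p.1 j ≠ 0) ∧ ∑ i, p.1 i + ∑ i, p.2 i = M then
    ((W p.1 p.2 * (2 ^ k * ∏ j, partialSum p.1 j)⁻¹ : ℝ) : ℂ) * Ψ p.1 p.2 else 0

/-- The weights of the composite series. -/
def annulusWeight (r : ℝ) (k l : ℕ) (a : Fin k → ℝ) (b : Fin l → ℝ) : ℝ :=
  timeOrdered r l b 1 * r ^ (2 * ∑ i, a i)

/-- The weights of the partially resummed composite series. -/
def resummedWeight (r : ℝ) (k l : ℕ) (a : Fin k → ℝ) (b : Fin l → ℝ) : ℝ :=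
  orderedIntegral r (fun s => s ^ (2 * ∑ i, a i)) l b 1

variable {Ψ : (k l : ℕ) → (Fin k → ℝ) → (Fin l → ℝ) → ℂ}

/-- Termwise form of the telescoping: `orderedIntegral_rpow_cons` solved for the upper endpoint term
and divided by the common denominators. -/
theorem compositeTerm_resummed_snoc {r : ℝ} (hr : 0 < r) (M : ℝ) (k l : ℕ)
    (hΨ : ∀ k l a t b, Ψ (k + 1) l (Fin.snoc a t) b = Ψ k (l + 1) a (Fin.cons t b))
    (a : Fin k → ℝ) (t : ℝ) (b : Fin l → ℝ) :
    compositeTerm M (k + 1) l (resummedWeight r (k + 1) l) (Ψ (k + 1) l) (Fin.snoc a t, b) =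
      compositeTerm M (k + 1) l (annulusWeight r (k + 1) l) (Ψ (k + 1) l) (Fin.snoc a t, b) +
      if ∑ i, a i + t = 0 then 0 else
        compositeTerm M k (l + 1) (resummedWeight r k (l + 1)) (Ψ k (l + 1))
          (a, Fin.cons t b) := by
  simp only [compositeTerm, forall_partialSum_snoc, prod_partialSum_snoc, sum_snoc, sum_cons, hΨ,
    ← add_assoc]
  by_cases ht : ∑ i, a i + t = 0
  · simp [ht]
  by_cases hc : (∀ j, partialSum a j ≠ 0) ∧ ∑ i, a i + t + ∑ i, b i = M
  swap
  · rw [if_neg fun h => hc ⟨h.1.1, h.2⟩, if_neg fun h => hc ⟨h.1.1, h.2⟩, if_neg ht, if_neg hc,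
      add_zero]
  rw [if_pos ⟨⟨hc.1, ht⟩, hc.2⟩, if_pos ⟨⟨hc.1, ht⟩, hc.2⟩, if_neg ht, if_pos hc, ← add_mul,
    ← Complex.ofReal_add]
  congr 2
  simp only [resummedWeight, annulusWeight, sum_snoc]
  rw [orderedIntegral_rpow_cons hr one_pos ht, pow_succ, mul_inv, mul_inv, mul_inv, mul_inv,
    mul_inv]
  ring

/-- The terms whose partial sums vanish for the first time at order `k + 1` cancel if the
obstruction of this order vanishes. -/
theorem hasSum_compositeTerm_of_obstruction {r : ℝ} (hr : 0 < r) (M : ℝ) (k l : ℕ)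
    (hΨ : ∀ k l a t b, Ψ (k + 1) l (Fin.snoc a t) b = Ψ k (l + 1) a (Fin.cons t b))
    (hsum : Summable (compositeTerm M k (l + 1) (resummedWeight r k (l + 1)) (Ψ k (l + 1))))
    (hobs : ∀ b : Fin l → ℝ, HasSum (obstructionTerm (k + 1) fun m => Ψ (k + 1) l m b) 0) :
    HasSum (fun p : (Fin k → ℝ) × ℝ × (Fin l → ℝ) => if ∑ i, p.1 i + p.2.1 = 0 then
      compositeTerm M k (l + 1) (resummedWeight r k (l + 1)) (Ψ k (l + 1))
        (p.1, Fin.cons p.2.1 p.2.2) else 0) 0 := by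
  -- The logarithmic integral depends only on the second tuple, so for fixed second tuple the sum
  -- over the first is an obstruction. The 2 compensates 2^(k+1) in the obstruction against 2^k in
  -- the composite.
  let K : (Fin (k + 1) → ℝ) × (Fin l → ℝ) → ℂ := fun p => if ∑ i, p.2 i = M then
    2 * (orderedIntegral r (fun s => Real.log (s / r)) l p.2 1 : ℂ) *
      obstructionTerm (k + 1) (fun m => Ψ (k + 1) l m p.2) p.1 else 0
  have hK : ∀ p : (Fin k → ℝ) × ℝ × (Fin l → ℝ), K (Fin.snoc p.1 p.2.1, p.2.2) =
      if ∑ i, p.1 i + p.2.1 = 0 then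
      compositeTerm M k (l + 1) (resummedWeight r k (l + 1)) (Ψ k (l + 1))
        (p.1, Fin.cons p.2.1 p.2.2) else 0 := by
    rintro ⟨a, t, b⟩
    simp only [K, obstructionTerm, compositeTerm, forall_lt_partialSum_snoc,
      prod_filter_partialSum_snoc, sum_snoc, sum_cons, hΨ, ← add_assoc]
    by_cases ht : ∑ i, a i + t = 0
    swap
    · simp [ht]
    simp only [ht, zero_add, and_true, if_true]
    by_cases hb : ∑ i, b i = M
    swap
    · simp [hb]
    simp only [hb, and_true, if_true]
    by_cases hg : ∀ j, partialSum a j ≠ 0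
    swap
    · simp [hg]
    rw [if_pos hg, if_pos hg, resummedWeight, orderedIntegral_rpow_cons_of_add_eq_zero hr one_pos ht,
      pow_succ]
    push_cast
    rw [mul_inv, mul_inv, mul_inv]
    ring
  have hKsum : Summable K := by
    have h1 := (tripleCons k l).summable_iff.2 hsum
    have h2 := h1.indicator {p | ∑ i, p.1 i + p.2.1 = 0}
    refine (tripleSnoc k l).summable_iff.1 (h2.congr fun p => ?_)
    have h3 := hK p
    simp only [Function.comp_apply, tripleSnoc, tripleCons, Equiv.coe_fn_mk, Set.indicator,
      Set.mem_ofPred_eq]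
    convert h3.symm using 1
  suffices h : HasSum K 0 from (hasSum_tripleSnoc_iff.2 h).of_eq (fun p => (hK p).symm) rfl
  have h1 := (Equiv.prodComm _ _).hasSum_iff.2 hKsum.hasSum
  have h2 := h1.prod_fiberwise (g := fun _ => 0) fun b => by
    by_cases hb : ∑ i, b i = M
    · refine ((hobs b).mul_left (2 * (orderedIntegral r (fun s => Real.log (s / r)) l b 1 : ℂ))).of_eq
        (fun m => ?_) (mul_zero _).symm
      simp [K, hb]
    · refine hasSum_zero.of_eq (fun m => ?_) rfl
      simp [K, hb]
  exact (hasSum_zero.unique h2) ▸ hKsum.hasSum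

/-- Resummation of the composite series of total order `n`. -/
theorem hasSum_resummed {r : ℝ} (hr : 0 < r) (M : ℝ) {n : ℕ}
    (hΨ : ∀ k l a t b, Ψ (k + 1) l (Fin.snoc a t) b = Ψ k (l + 1) a (Fin.cons t b))
    {y : ℕ → ℂ}
    (hy : ∀ k l, k + l = n → k < n →
      HasSum (compositeTerm M k l (annulusWeight r k l) (Ψ k l)) (y k))
    (hobs : ∀ k l, k + 1 + l = n → k + 1 < n →
      ∀ b : Fin l → ℝ, HasSum (obstructionTerm (k + 1) fun m => Ψ (k + 1) l m b) 0)
    (k l : ℕ) (hkl : k + l = n) (hk : k < n) :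
    HasSum (compositeTerm M k l (resummedWeight r k l) (Ψ k l))
      (∑ i ∈ Finset.range (k + 1), y i) := by
  induction k generalizing l with
  | zero =>
    refine (hy 0 l hkl hk).of_eq (fun p => ?_) (by simp)
    -- For k = 0 the innermost factor is s^0 = 1, so the telescoping starts from the series of the
    -- annulus applied to `u`.
    have : annulusWeight r 0 l = resummedWeight r 0 l := by
      funext a b
      simp only [annulusWeight, resummedWeight, timeOrdered_eq_orderedIntegral,
        Finset.univ_eq_empty, Finset.sum_empty, mul_zero, Real.rpow_zero, mul_one]
      rfl
    rw [this]
  | succ k ih =>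
    have h0 := ih (l + 1) (by omega) (by omega)
    have h1 := hasSum_compositeTerm_of_obstruction hr M k l hΨ h0.summable (hobs k l hkl hk)
    have h2 := hasSum_tripleSnoc_iff.2 (hy (k + 1) l hkl hk)
    -- The previous resummed series without its resonant terms, plus the new annulus contribution.
    have h3 := h2.add ((hasSum_tripleCons_iff.2 h0).sub h1)
    rw [← hasSum_tripleSnoc_iff]
    refine h3.of_eq (fun p => ?_) ?_
    · rw [compositeTerm_resummed_snoc hr M k l hΨ]
      split_ifs <;> simp
    · rw [Finset.sum_range_succ, sub_zero, add_comm]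

theorem hasSum_snoc_elim0_iff {k : ℕ} {F : (Fin (k + 1) → ℝ) → ℂ} {S : ℂ} :
    HasSum (fun p : (Fin k → ℝ) × ℝ × (Fin 0 → ℝ) => F (Fin.snoc p.1 p.2.1)) S ↔ HasSum F S := by
  rw [← (Equiv.prodUnique (Fin (k + 1) → ℝ) (Fin 0 → ℝ)).hasSum_iff]
  exact hasSum_tripleSnoc_iff (F := F ∘ Equiv.prodUnique (Fin (k + 1) → ℝ) (Fin 0 → ℝ))

/-- End of the telescoping: one integral over [r,1] of s^(2M-1) remains, equal to (1 - r^(2M))/(2M),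
and its denominator completes that of the correction. -/
theorem hasSum_correctionTerm {r : ℝ} (hr : r ∈ Set.Ioo (0 : ℝ) 1) {M : ℝ} (hM : M ≠ 0) {n : ℕ}
    (hΨ : ∀ k l a t b, Ψ (k + 1) l (Fin.snoc a t) b = Ψ k (l + 1) a (Fin.cons t b))
    {y : ℕ → ℂ}
    (hy : ∀ k l, k + l = n + 1 → k < n + 1 →
      HasSum (compositeTerm M k l (annulusWeight r k l) (Ψ k l)) (y k))
    (hobs : ∀ k l, k + 1 + l = n + 1 → k + 1 < n + 1 →
      ∀ b : Fin l → ℝ, HasSum (obstructionTerm (k + 1) fun m => Ψ (k + 1) l m b) 0) :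
    HasSum (fun m => ((1 - r ^ (2 * M) : ℝ) : ℂ) *
      correctionTerm M (n + 1) (fun m => Ψ (n + 1) 0 m Fin.elim0) m)
      (∑ i ∈ Finset.range (n + 1), y i) := by
  have h0 := hasSum_tripleCons_iff.2 (hasSum_resummed hr.1 M hΨ hy hobs n 1 rfl (by omega))
  rw [← hasSum_snoc_elim0_iff]
  refine h0.of_eq (fun p => ?_) rfl
  obtain ⟨a, t, b⟩ := p
  obtain rfl : b = Fin.elim0 := Subsingleton.elim _ _
  simp only [correctionTerm, compositeTerm, forall_partialSum_snoc, prod_partialSum_snoc, sum_snoc,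
    sum_cons, hΨ, Finset.univ_eq_empty, Finset.sum_empty, add_zero]
  by_cases hc : (∀ j, partialSum a j ≠ 0) ∧ ∑ i, a i + t = M
  swap
  · rw [if_neg fun h => hc ⟨h.1.1, h.2⟩, if_neg hc, mul_zero]
  have ht : ∑ i, a i + t ≠ 0 := hc.2 ▸ hM
  rw [if_pos ⟨⟨hc.1, ht⟩, hc.2⟩, if_pos hc, ← mul_assoc, ← Complex.ofReal_mul]
  congr 2
  rw [resummedWeight, orderedIntegral_rpow_cons hr.1 one_pos ht, hc.2]
  simp only [orderedIntegral, timeOrdered, Real.one_rpow, mul_one]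
  rw [pow_succ, mul_inv, mul_inv, mul_inv, mul_inv, mul_inv]
  ring

/-- Same endpoint in relative weight zero, where the last integral is -log r and no further
denominator arises. -/
theorem hasSum_obstructionTerm {r : ℝ} (hr : r ∈ Set.Ioo (0 : ℝ) 1) {n : ℕ}
    (hΨ : ∀ k l a t b, Ψ (k + 1) l (Fin.snoc a t) b = Ψ k (l + 1) a (Fin.cons t b))
    {y : ℕ → ℂ}
    (hy : ∀ k l, k + l = n + 1 → k < n + 1 →
      HasSum (compositeTerm 0 k l (annulusWeight r k l) (Ψ k l)) (y k))
    (hobs : ∀ k l, k + 1 + l = n + 1 → k + 1 < n + 1 →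
      ∀ b : Fin l → ℝ, HasSum (obstructionTerm (k + 1) fun m => Ψ (k + 1) l m b) 0) :
    HasSum (fun m => ((-(2 * Real.log r) : ℝ) : ℂ) *
      obstructionTerm (n + 1) (fun m => Ψ (n + 1) 0 m Fin.elim0) m)
      (∑ i ∈ Finset.range (n + 1), y i) := by
  have h0 := hasSum_tripleCons_iff.2 (hasSum_resummed hr.1 0 hΨ hy hobs n 1 rfl (by omega))
  rw [← hasSum_snoc_elim0_iff]
  refine h0.of_eq (fun p => ?_) rfl
  obtain ⟨a, t, b⟩ := p
  obtain rfl : b = Fin.elim0 := Subsingleton.elim _ _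
  simp only [obstructionTerm, compositeTerm, forall_lt_partialSum_snoc, prod_filter_partialSum_snoc,
    sum_snoc, sum_cons, hΨ, Finset.univ_eq_empty, Finset.sum_empty, add_zero]
  by_cases hc : (∀ j, partialSum a j ≠ 0) ∧ ∑ i, a i + t = 0
  swap
  · rw [if_neg hc, if_neg hc, mul_zero]
  rw [if_pos hc, if_pos hc, ← mul_assoc, ← Complex.ofReal_mul]
  congr 2
  rw [resummedWeight, orderedIntegral_rpow_cons_of_add_eq_zero hr.1 one_pos hc.2]
  simp only [orderedIntegral, one_div, Real.log_inv]
  rw [pow_succ, mul_inv, mul_inv, mul_inv]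
  ring

end PartialSums

end

noncomputable section

/-! ### Corrections of the deforming field -/

section WeakSums

variable {V : Type*} [AddCommGroup V] [Module ℂ V]

theorem eq_of_forall_dual_apply_eq {x y : V} (h : ∀ φ : Module.Dual ℂ V, φ x = φ y) : x = y := by
  rw [← sub_eq_zero, ← Module.forall_dual_apply_eq_zero_iff ℂ]
  intro φ
  rw [map_sub, h, sub_self]

theorem WeakHasSum.unique {ι : Type*} {g : ι → V} {x y : V} (hx : WeakHasSum g x)
    (hy : WeakHasSum g y) : x = y :=
  eq_of_forall_dual_apply_eq fun φ => (hx φ).unique (hy φ)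

/-- A subspace is the intersection of the kernels of the functionals vanishing on it. -/
theorem WeakHasSum.mem {ι : Type*} {g : ι → V} {x : V} (hx : WeakHasSum g x) {W : Submodule ℂ V}
    (hg : ∀ i, g i ∈ W) : x ∈ W := by
  by_contra hW
  obtain ⟨φ, hφ, hker⟩ := W.exists_le_ker_of_notMem hW
  refine hφ ((hx φ).unique (hasSum_zero.of_eq (fun i => ?_) rfl))
  exact hker (hg i)

end WeakSums

namespace ConformalFieldTheory

variable {V : Type*} [AddCommGroup V] [Module ℂ V] {T : ConformalFieldTheory V}

theorem HatApply.unique {A : V →ₗ[ℂ] T.Hat} {x y y' : T.Hat} (h : T.HatApply A x y)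
    (h' : T.HatApply A x y') : y = y' :=
  funext fun ω => Subtype.ext ((h ω).unique (h' ω))

/-- The mode series for a correction, including its component of weight `(Δ, Δ)`. -/
def IsFullSeries (T : ConformalFieldTheory V) (Δ : ℝ) (v u : V) (k : ℕ) (x : T.Hat) : Prop :=
  T.IsSpinless x ∧ ∀ (M : ℝ) (φ : Module.Dual ℂ V),
    HasSum (correctionTerm M k fun m => φ (T.modeProd v k m u)) (φ (x (Δ + M, Δ + M)))

theorem weakHasSum_correction_iff {v u : V} {k : ℕ} {M : ℝ} {x : V} :
    WeakHasSum (Set.indicator {m : Fin k → ℝ | (∀ j, partialSum m j ≠ 0) ∧ ∑ i, m i = M}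
      (fun m => (((2 ^ k * ∏ j, partialSum m j)⁻¹ : ℝ) : ℂ) • T.modeProd v k m u)) x ↔
    ∀ φ : Module.Dual ℂ V,
      HasSum (correctionTerm M k fun m => φ (T.modeProd v k m u)) (φ x) := by
  refine forall_congr' fun φ => ?_
  have : (fun m : Fin k → ℝ => φ (Set.indicator
      {m : Fin k → ℝ | (∀ j, partialSum m j ≠ 0) ∧ ∑ i, m i = M}
      (fun m => (((2 ^ k * ∏ j, partialSum m j)⁻¹ : ℝ) : ℂ) • T.modeProd v k m u) m)) =
      correctionTerm M k fun m => φ (T.modeProd v k m u) := by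
    funext m
    simp only [Set.indicator, Set.mem_ofPred_eq, correctionTerm]
    split_ifs <;> simp
  rw [this]

theorem obstructionVanishes_iff {v u : V} {k : ℕ} : T.ObstructionVanishes v u k ↔
    ∀ φ : Module.Dual ℂ V, HasSum (obstructionTerm k fun m => φ (T.modeProd v k m u)) 0 := by
  refine forall_congr' fun φ => ?_
  have : (fun m : Fin k → ℝ => φ (Set.indicator {m : Fin k → ℝ |
        (∀ j : Fin k, (j : ℕ) + 1 < k → partialSum m j ≠ 0) ∧ ∑ i, m i = 0}
      (fun m => (((2 ^ k * ∏ j ∈ Finset.univ.filter (fun j : Fin k => (j : ℕ) + 1 < k),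
          partialSum m j)⁻¹ : ℝ) : ℂ) • T.modeProd v k m u) m)) =
      obstructionTerm k fun m => φ (T.modeProd v k m u) := by
    funext m
    simp only [Set.indicator, Set.mem_ofPred_eq, obstructionTerm]
    split_ifs <;> simp
  rw [this, map_zero]

/-- Matrix elements of composites of products of modes. -/
def modePairing (T : ConformalFieldTheory V) (v u : V) (φ : Module.Dual ℂ V) (k l : ℕ)
    (a : Fin k → ℝ) (b : Fin l → ℝ) : ℂ :=
  φ (T.modeProd v l b (T.modeProd v k a u))

theorem modePairing_snoc (v u : V) (φ : Module.Dual ℂ V) (k l : ℕ)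
    (a : Fin k → ℝ) (t : ℝ) (b : Fin l → ℝ) :
    T.modePairing v u φ (k + 1) l (Fin.snoc a t) b =
      T.modePairing v u φ k (l + 1) a (Fin.cons t b) := by
  simp only [modePairing, modeProd_cons, modeProd_snoc, Module.End.mul_apply]

/-- Regroup the composite series by the weight of the intermediate state. In each group the sum over
the annulus modes is taken first; what is left is the series of the correction tested on φ composed
with the annulus. -/
theorem hasSum_annulus_apply {Δ : ℝ} {v u : V} {U : ℝ → V →ₗ[ℂ] T.Hat} {k l : ℕ} {r : ℝ}
    (hr : 0 < r) (hu : u ∈ T.gr (Δ, Δ))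
    (hU : ∀ κ, ∀ y ∈ T.gr κ, T.IsTimeOrderedSeries v l r κ y (U r y)) {x : T.Hat}
    (hx : T.IsFullSeries Δ v u k x) (M : ℝ) (φ : Module.Dual ℂ V)
    {S : ℂ} (hS : HasSum (compositeTerm M k l (annulusWeight r k l) (T.modePairing v u φ k l)) S) :
    HasSum (fun w => φ (U r (x w) (Δ + M, Δ + M))) (((r ^ (2 * Δ) : ℝ) : ℂ) * S) := by
  refine (hS.mul_left ((r ^ (2 * Δ) : ℝ) : ℂ)).fiberwise
    (fun p => (Δ + ∑ i, p.1 i, Δ + ∑ i, p.1 i)) fun w => ?_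
  by_cases hw : ∃ N : ℝ, w = (Δ + N, Δ + N)
  swap
  · have h1 : w.1 ≠ w.2 := fun h => hw ⟨w.1 - Δ, Prod.ext (by simp) (by simp [h])⟩
    refine hasSum_zero.of_eq (fun p => Set.indicator_of_notMem (fun hp => hw ?_) _) ?_
    · exact ⟨∑ i, p.1 i, hp.symm⟩
    · rw [hx.1 w h1]
      simp
  obtain ⟨N, rfl⟩ := hw
  let ψ : Module.Dual ℂ V := φ ∘ₗ (T.gr (Δ + M, Δ + M)).subtype ∘ₗ
    LinearMap.proj (Δ + M, Δ + M) ∘ₗ U r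
  have hψ : ∀ z, ψ z = φ (U r z (Δ + M, Δ + M)) := fun z => rfl
  rw [← hψ]
  have hfib : ∀ a : Fin k → ℝ,
      (Δ + ∑ i, a i, Δ + ∑ i, a i) = (Δ + N, Δ + N) ↔ ∑ i, a i = N := fun a => by
    simp
  set G : (Fin k → ℝ) × (Fin l → ℝ) → ℂ := Set.indicator
    ((fun p : (Fin k → ℝ) × (Fin l → ℝ) => (Δ + ∑ i, p.1 i, Δ + ∑ i, p.1 i)) ⁻¹'
      {(Δ + N, Δ + N)})
    (fun p => ((r ^ (2 * Δ) : ℝ) : ℂ) *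
      compositeTerm M k l (annulusWeight r k l) (T.modePairing v u φ k l) p) with hG
  have hGsum : Summable G := (hS.summable.mul_left _).indicator _
  have hfiber := hGsum.hasSum.prod_fiberwise
    (g := correctionTerm N k fun m => ψ (T.modeProd v k m u)) fun a => by
    by_cases ha : (∀ j, partialSum a j ≠ 0) ∧ ∑ i, a i = N
    swap
    · rw [correctionTerm, if_neg ha]
      refine hasSum_zero.of_eq (fun b => ?_) rfl
      simp only [hG, Set.indicator, Set.mem_preimage, Set.mem_singleton_iff, hfib, compositeTerm]
      split_ifs with h1 h2
      · exact absurd ⟨h2.1, h1⟩ ha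
      · simp
      · rfl
    have hz := modeProd_mem v hu k a
    have hin := (isTimeOrderedSeries_iff.1 (hU _ _ hz) (Δ + M, Δ + M) φ).mul_left
      (((2 ^ k * ∏ j, partialSum a j)⁻¹ : ℝ) : ℂ)
    refine hin.of_eq (fun b => ?_) ?_
    · simp only [hG, Set.indicator, Set.mem_preimage, Set.mem_singleton_iff, compositeTerm,
        modeCoeff_zero_right, ha.2]
      have hcond : (Δ, Δ) + (N, N) + (∑ i, b i, ∑ i, b i) = (Δ + M, Δ + M) ↔
          N + ∑ i, b i = M := by
        simp [add_assoc]
      have hiff : ((∀ j, partialSum a j ≠ 0) ∧ N + ∑ i, b i = M) ↔ N + ∑ i, b i = M :=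
        and_iff_right ha.1
      simp only [hcond, hiff, if_true, modePairing, annulusWeight, ha.2]
      split_ifs
      · have hpow : (r ^ (2 * Δ)) * r ^ (2 * N) = r ^ (((Δ, Δ) + (N, N)).1 + ((Δ, Δ) + (N, N)).2) := by
          rw [← Real.rpow_add hr]
          congr 1
          simp only [Prod.mk_add_mk]
          ring
        rw [← hpow]
        push_cast
        ring
      · simp
    · rw [correctionTerm, if_pos ha, hψ]
  exact (hx.2 N ψ).unique hfiber ▸ hGsum.hasSum

/-- Applying an annulus to a correction which is given by its mode series. -/
theorem exists_hatApply {Δ : ℝ} {v u : V} {U : ℝ → V →ₗ[ℂ] T.Hat} {k l h : ℕ} {r : ℝ}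
    (hr : r ∈ Set.Ioo (0 : ℝ) 1) (hu : u ∈ T.gr (Δ, Δ))
    (hU : ∀ κ, ∀ y ∈ T.gr κ, T.IsTimeOrderedSeries v l r κ y (U r y)) {x : T.Hat}
    (hx : T.IsFullSeries Δ v u k x) (hc : T.ModeSeriesConverge v u h) (hkl : k + l ≤ h) :
    ∃ y : T.Hat, T.HatApply (U r) x y ∧ T.IsSpinless y ∧ ∀ (M : ℝ) (φ : Module.Dual ℂ V),
      HasSum (compositeTerm M k l (annulusWeight r k l) (T.modePairing v u φ k l))
        (((r ^ (2 * Δ) : ℝ) : ℂ)⁻¹ * φ (y (Δ + M, Δ + M))) := by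
  have hr2 : ((r ^ (2 * Δ) : ℝ) : ℂ) ≠ 0 :=
    Complex.ofReal_ne_zero.2 (Real.rpow_pos_of_pos hr.1 _).ne'
  choose X hX using hc.composite k l hkl r hr
  have hX' : ∀ M (φ : Module.Dual ℂ V),
      HasSum (compositeTerm M k l (annulusWeight r k l) (T.modePairing v u φ k l)) (φ (X M)) := by
    intro M φ
    refine (hX M φ).of_eq (fun p => ?_) rfl
    simp only [Set.indicator, Set.mem_ofPred_eq, compositeTerm, annulusWeight, modePairing]
    split_ifs <;> simp
  have hsum : ∀ M (φ : Module.Dual ℂ V), HasSum (fun w => φ (U r (x w) (Δ + M, Δ + M)))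
      (φ (((r ^ (2 * Δ) : ℝ) : ℂ) • X M)) := fun M φ => by
    rw [map_smul, smul_eq_mul]
    exact hasSum_annulus_apply hr.1 hu hU hx M φ (hX' M φ)
  have hmem : ∀ M, ((r ^ (2 * Δ) : ℝ) : ℂ) • X M ∈ T.gr (Δ + M, Δ + M) := fun M =>
    WeakHasSum.mem (hsum M) fun w => (U r (x w) (Δ + M, Δ + M)).2
  -- The condition on ω says that it is diagonal, written so that membership can be transported; off
  -- the diagonal the component is 0.
  let y : T.Hat := fun ω => open Classical in
    if hω : (Δ + (ω.1 - Δ), Δ + (ω.1 - Δ)) = ω then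
      ⟨((r ^ (2 * Δ) : ℝ) : ℂ) • X (ω.1 - Δ), by
      have h := hmem (ω.1 - Δ)
      rwa [hω] at h⟩ else 0
  have hy : ∀ M, (y (Δ + M, Δ + M) : V) = ((r ^ (2 * Δ) : ℝ) : ℂ) • X M := fun M => by
    simp [y]
  have hy0 : T.IsSpinless y := fun ω hω => by
    simp only [y]
    rw [dif_neg]
    intro h
    apply hω
    have h1 := congrArg Prod.snd h
    simp only at h1
    linarith
  refine ⟨y, fun ω => ?_, hy0, fun M φ => ?_⟩
  · by_cases hω : ω.1 = ω.2
    · have : ω = (Δ + (ω.1 - Δ), Δ + (ω.1 - Δ)) := Prod.ext (by simp) (by simp [hω])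
      rw [this]
      intro φ
      rw [hy]
      exact hsum _ φ
    · intro φ
      rw [hy0 ω hω]
      refine hasSum_zero.of_eq (fun w => ?_) (map_zero φ)
      by_cases hw : w.1 = w.2
      swap
      · simp [hx.1 w hw]
      refine (isTimeOrderedSeries_iff.1 (hU w _ (x w).2) ω φ).unique
        (hasSum_zero.of_eq (fun m => ?_) rfl)
      rw [modeCoeff_zero_right, if_neg, mul_zero, mul_zero]
      rintro rfl
      simp [hw] at hω
  · rw [hy, map_smul, smul_eq_mul, inv_mul_cancel_left₀ hr2]
    exact hX' M φ

end ConformalFieldTheory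

end

/-! ### The equation for the next correction, and the theorem -/

noncomputable section

namespace ConformalFieldTheory

variable {V : Type*} [AddCommGroup V] [Module ℂ V] {T : ConformalFieldTheory V}

theorem hatApply_annulus_zero {U : V →ₗ[ℂ] T.Hat} {r : ℝ}
    (hU : ∀ κ, ∀ v ∈ T.gr κ, (U v κ : V) = ((r ^ (κ.1 + κ.2) : ℝ) : ℂ) • v ∧
      ∀ ω, ω ≠ κ → U v ω = 0) (x : T.Hat) :
    T.HatApply U x fun ω => ((r ^ (ω.1 + ω.2) : ℝ) : ℂ) • x ω := by
  intro ω φ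
  refine (hasSum_single ω fun w hw => ?_).of_eq (fun _ => rfl) ?_
  · simp [(hU w _ (x w).2).2 ω hw.symm]
  · simp [(hU ω _ (x ω).2).1]

/-- The contribution of the lower corrections to the equation for the correction of order
`n + 1`. -/
theorem exists_lowerContribution {Δ : ℝ} {v u : V} {U : ℕ → ℝ → V →ₗ[ℂ] T.Hat} {f : ℕ → T.Hat}
    {h n : ℕ} (hu : u ∈ T.gr (Δ, Δ)) (hn : n + 1 ≤ h)
    (hU : ∀ k ≤ h, ∀ r ∈ Set.Ioo (0 : ℝ) 1, ∀ κ, ∀ y ∈ T.gr κ,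
      T.IsTimeOrderedSeries v k r κ y (U k r y))
    (hU0 : ∀ r ∈ Set.Ioo (0 : ℝ) 1, ∀ κ, ∀ v ∈ T.gr κ,
      (U 0 r v κ : V) = ((r ^ (κ.1 + κ.2) : ℝ) : ℂ) • v ∧ ∀ ω, ω ≠ κ → U 0 r v ω = 0)
    (hc : T.ModeSeriesConverge v u h)
    (hf : ∀ k < n + 1, T.IsFullSeries Δ v u k (f k))
    (hobs : ∀ k, 1 ≤ k → k < n + 1 → T.ObstructionVanishes v u k)
    {r : ℝ} (hr : r ∈ Set.Ioo (0 : ℝ) 1) :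
    ∃ Y : T.Hat, T.IsSpinless Y ∧
      ((∃ y : ℕ → T.Hat, (∀ j ≤ n + 1, T.HatApply (U (n + 1 - j) r) (f j) (y j)) ∧
          ∑ j ∈ Finset.range (n + 1 + 1), y j = ((r ^ (2 * Δ) : ℝ) : ℂ) • f (n + 1)) ↔
        ∀ ω, (Y ω : V) + ((r ^ (ω.1 + ω.2) : ℝ) : ℂ) • (f (n + 1) ω : V) =
          ((r ^ (2 * Δ) : ℝ) : ℂ) • (f (n + 1) ω : V)) ∧
      (∀ M ≠ 0, ∀ φ : Module.Dual ℂ V, HasSum (fun m => ((1 - r ^ (2 * M) : ℝ) : ℂ) *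
        correctionTerm M (n + 1) (fun m => φ (T.modeProd v (n + 1) m u)) m)
        (((r ^ (2 * Δ) : ℝ) : ℂ)⁻¹ * φ (Y (Δ + M, Δ + M)))) ∧
      ∀ φ : Module.Dual ℂ V, HasSum (fun m => ((-(2 * Real.log r) : ℝ) : ℂ) *
        obstructionTerm (n + 1) (fun m => φ (T.modeProd v (n + 1) m u)) m)
        (((r ^ (2 * Δ) : ℝ) : ℂ)⁻¹ * φ (Y (Δ, Δ))) := by
  -- Stated for all k, with a default value beyond n, so that a total sequence can be chosen.
  have hex : ∀ k, ∃ y : T.Hat, k < n + 1 → T.HatApply (U (n + 1 - k) r) (f k) y ∧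
      T.IsSpinless y ∧ ∀ (M : ℝ) (φ : Module.Dual ℂ V),
      HasSum (compositeTerm M k (n + 1 - k) (annulusWeight r k (n + 1 - k))
        (T.modePairing v u φ k (n + 1 - k)))
        (((r ^ (2 * Δ) : ℝ) : ℂ)⁻¹ * φ (y (Δ + M, Δ + M))) := by
    intro k
    by_cases hk : k < n + 1
    · obtain ⟨y, hy⟩ := exists_hatApply hr hu (hU (n + 1 - k) (by omega) r hr) (hf k hk) hc
        (l := n + 1 - k) (by omega)
      exact ⟨y, fun _ => hy⟩
    · exact ⟨0, fun h => absurd h hk⟩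
  choose y hy using hex
  have hsumapp : ∀ ω, ((∑ k ∈ Finset.range (n + 1), y k : T.Hat) ω : V) =
      ∑ k ∈ Finset.range (n + 1), (y k ω : V) := fun ω => by
    rw [Finset.sum_apply, Submodule.coe_sum]
  have hsum : ∀ (M : ℝ) (φ : Module.Dual ℂ V), ∑ k ∈ Finset.range (n + 1),
      ((r ^ (2 * Δ) : ℝ) : ℂ)⁻¹ * φ (y k (Δ + M, Δ + M)) = ((r ^ (2 * Δ) : ℝ) : ℂ)⁻¹ *
        φ ((∑ k ∈ Finset.range (n + 1), y k : T.Hat) (Δ + M, Δ + M)) := fun M φ => by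
    rw [hsumapp, map_sum, Finset.mul_sum]
  have hcomp : ∀ (M : ℝ) (φ : Module.Dual ℂ V) (k l : ℕ), k + l = n + 1 → k < n + 1 →
      HasSum (compositeTerm M k l (annulusWeight r k l) (T.modePairing v u φ k l))
        (((r ^ (2 * Δ) : ℝ) : ℂ)⁻¹ * φ (y k (Δ + M, Δ + M))) := by
    intro M φ k l hkl hk
    obtain rfl : l = n + 1 - k := by omega
    exact (hy k hk).2.2 M φ
  -- The annulus modes applied after the obstruction are part of the functional on which it is
  -- tested.
  have hobs' : ∀ (φ : Module.Dual ℂ V) (k l : ℕ), k + 1 + l = n + 1 → k + 1 < n + 1 →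
      ∀ b : Fin l → ℝ,
      HasSum (obstructionTerm (k + 1) fun m => T.modePairing v u φ (k + 1) l m b) 0 :=
    fun φ k l _ hk b => obstructionVanishes_iff.1 (hobs (k + 1) (by omega) hk)
      (φ ∘ₗ T.modeProd v l b)
  refine ⟨∑ k ∈ Finset.range (n + 1), y k, fun ω hω => ?_, ⟨?_, fun hY => ?_⟩, fun M hM φ => ?_,
    fun φ => ?_⟩
  · rw [Finset.sum_apply]
    exact Finset.sum_eq_zero fun k hk => (hy k (Finset.mem_range.1 hk)).2.1 ω hω
  · rintro ⟨y', hy', hsum'⟩ ω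
    have h1 : ∀ k ∈ Finset.range (n + 1), y' k = y k := fun k hk =>
      (hy' k (Finset.mem_range.1 hk).le).unique (hy k (Finset.mem_range.1 hk)).1
    have h2 := hy' (n + 1) le_rfl
    rw [Nat.sub_self] at h2
    have h3 := h2.unique (hatApply_annulus_zero (hU0 r hr) (f (n + 1)))
    rw [Finset.sum_range_succ, Finset.sum_congr rfl h1, h3] at hsum'
    simpa using congrArg (fun z : T.Hat => (z ω : V)) hsum'
  · refine ⟨fun k => if k < n + 1 then y k else
      fun ω => ((r ^ (ω.1 + ω.2) : ℝ) : ℂ) • f (n + 1) ω, fun k hk => ?_, ?_⟩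
    · by_cases hk' : k < n + 1
      · simp only [hk', if_true]
        exact (hy k hk').1
      · obtain rfl : k = n + 1 := by omega
        simp only [lt_irrefl, if_false, Nat.sub_self]
        exact hatApply_annulus_zero (hU0 r hr) (f (n + 1))
    · rw [Finset.sum_range_succ, Finset.sum_congr rfl fun k hk => if_pos (Finset.mem_range.1 hk),
        if_neg (lt_irrefl _)]
      funext ω
      refine Subtype.ext ?_
      simpa using hY ω
  · rw [← hsum]
    exact hasSum_correctionTerm hr hM (modePairing_snoc v u φ) (hcomp M φ) (hobs' φ)
  · have h1 := hasSum_obstructionTerm hr (modePairing_snoc v u φ) (hcomp 0 φ) (hobs' φ)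
    rw [hsum, add_zero] at h1
    exact h1

theorem isCorrectionSeries_iff {Δ : ℝ} {v u : V} {k : ℕ} {x : T.Hat} :
    T.IsCorrectionSeries Δ v u k x ↔ T.IsSpinless x ∧ ∀ M ≠ 0, ∀ φ : Module.Dual ℂ V,
      HasSum (correctionTerm M k fun m => φ (T.modeProd v k m u)) (φ (x (Δ + M, Δ + M))) := by
  simp only [IsCorrectionSeries, weakHasSum_correction_iff, ne_eq]

theorem one_sub_rpow_ne_zero {r M : ℝ} (hr : r ∈ Set.Ioo (0 : ℝ) 1) (hM : M ≠ 0) :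
    ((1 - r ^ (2 * M) : ℝ) : ℂ) ≠ 0 := by
  rw [Complex.ofReal_ne_zero, sub_ne_zero, ne_comm]
  rcases hM.lt_or_gt with h | h
  · exact (Real.one_lt_rpow_of_pos_of_lt_one_of_neg hr.1 hr.2 (by linarith)).ne'
  · exact (Real.rpow_lt_one hr.1.le hr.2 (by linarith)).ne

theorem neg_two_mul_log_ne_zero {r : ℝ} (hr : r ∈ Set.Ioo (0 : ℝ) 1) :
    ((-(2 * Real.log r) : ℝ) : ℂ) ≠ 0 := by
  have := Real.log_neg hr.1 hr.2
  exact Complex.ofReal_ne_zero.2 (by linarith)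

theorem rpow_ne_zero_ofReal {r : ℝ} (hr : r ∈ Set.Ioo (0 : ℝ) 1) (p : ℝ) :
    ((r ^ p : ℝ) : ℂ) ≠ 0 :=
  Complex.ofReal_ne_zero.2 (Real.rpow_pos_of_pos hr.1 _).ne'

theorem hasSum_mul_left_cancel {ι : Type*} {g : ι → ℂ} {c x : ℂ} (hc : c ≠ 0)
    (h : HasSum (fun i => c * g i) x) : HasSum g (c⁻¹ * x) :=
  (h.mul_left c⁻¹).of_eq (fun _ => (inv_mul_cancel_left₀ hc _).symm) rfl

/-- The correction of order `n + 1` is determined by the lower ones, up to a vector of weight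
`(Δ, Δ)`, and exists if and only if the obstruction vanishes. -/
theorem isAnnulusPrimaryAt_iff {Δ : ℝ} {v u : V} {U : ℕ → ℝ → V →ₗ[ℂ] T.Hat} {f : ℕ → T.Hat}
    {h n : ℕ} (hu : u ∈ T.gr (Δ, Δ)) (hn : n + 1 ≤ h)
    (hU : ∀ k ≤ h, ∀ r ∈ Set.Ioo (0 : ℝ) 1, ∀ κ, ∀ y ∈ T.gr κ,
      T.IsTimeOrderedSeries v k r κ y (U k r y))
    (hU0 : ∀ r ∈ Set.Ioo (0 : ℝ) 1, ∀ κ, ∀ v ∈ T.gr κ,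
      (U 0 r v κ : V) = ((r ^ (κ.1 + κ.2) : ℝ) : ℂ) • v ∧ ∀ ω, ω ≠ κ → U 0 r v ω = 0)
    (hc : T.ModeSeriesConverge v u h)
    (hf : ∀ k < n + 1, T.IsFullSeries Δ v u k (f k))
    (hobs : ∀ k, 1 ≤ k → k < n + 1 → T.ObstructionVanishes v u k) :
    T.IsSpinless (f (n + 1)) ∧ T.IsAnnulusPrimaryAt Δ U f (n + 1) ↔
      T.ObstructionVanishes v u (n + 1) ∧ T.IsCorrectionSeries Δ v u (n + 1) (f (n + 1)) := by
  have hlow := fun {r : ℝ} (hr : r ∈ Set.Ioo (0 : ℝ) 1) =>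
    exists_lowerContribution hu hn hU hU0 hc hf hobs hr
  have hpow : ∀ {r : ℝ}, r ∈ Set.Ioo (0 : ℝ) 1 → ∀ M, ((r ^ (Δ + M + (Δ + M)) : ℝ) : ℂ) =
      ((r ^ (2 * Δ) : ℝ) : ℂ) * ((r ^ (2 * M) : ℝ) : ℂ) := fun hr M => by
    rw [← Complex.ofReal_mul, ← Real.rpow_add hr.1]
    ring_nf
  rw [isCorrectionSeries_iff, obstructionVanishes_iff]
  constructor
  · rintro ⟨hs, hp⟩
    -- A single radius determines the correction; the converse below checks all radii.
    have hr : (1 / 2 : ℝ) ∈ Set.Ioo (0 : ℝ) 1 := by norm_num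
    obtain ⟨Y, -, hiff, hM, h0⟩ := hlow hr
    have hY := hiff.1 (hp _ hr)
    have hne := rpow_ne_zero_ofReal hr (2 * Δ)
    refine ⟨fun φ => ?_, hs, fun M hM0 φ => ?_⟩
    · refine (hasSum_mul_left_cancel (neg_two_mul_log_ne_zero hr) (h0 φ)).of_eq (fun _ => rfl) ?_
      -- In weight (Δ,Δ) the unknown has the same coefficient on both sides and drops out.
      have h1 : (Y (Δ, Δ) : V) = 0 := by
        have := hY (Δ, Δ)
        rw [show (2 * Δ) = (Δ, Δ).1 + (Δ, Δ).2 from two_mul Δ] at this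
        simpa using this
      simp [h1]
    · refine (hasSum_mul_left_cancel (one_sub_rpow_ne_zero hr hM0) (hM M hM0 φ)).of_eq
        (fun _ => rfl) ?_
      have h1 := congrArg φ (hY (Δ + M, Δ + M))
      simp only [map_add, map_smul, smul_eq_mul] at h1
      rw [hpow hr] at h1
      have h2 := one_sub_rpow_ne_zero hr hM0
      rw [Complex.ofReal_sub, Complex.ofReal_one] at h2 ⊢
      field_simp
      linear_combination -h1
  · rintro ⟨ho, hs, hcorr⟩
    refine ⟨hs, fun r hr => ?_⟩
    obtain ⟨Y, hYs, hiff, hM, h0⟩ := hlow hr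
    have hne := rpow_ne_zero_ofReal hr (2 * Δ)
    refine hiff.2 fun ω => ?_
    by_cases hω : ω.1 = ω.2
    swap
    · rw [hYs ω hω, hs ω hω]
      simp
    obtain ⟨M, rfl⟩ : ∃ M, ω = (Δ + M, Δ + M) :=
      ⟨ω.1 - Δ, Prod.ext (by simp) (by simp [hω])⟩
    refine eq_of_forall_dual_apply_eq fun φ => ?_
    simp only [map_add, map_smul, smul_eq_mul]
    rw [hpow hr]
    by_cases hM0 : M = 0
    · subst hM0
      have h1 := (h0 φ).unique ((ho φ).mul_left _)
      rw [mul_zero, mul_eq_zero] at h1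
      have h2 := h1.resolve_left (inv_ne_zero hne)
      rw [add_zero, h2]
      simp
    · have h1 := (hM M hM0 φ).unique ((hcorr M hM0 φ).mul_left _)
      rw [inv_mul_eq_iff_eq_mul₀ hne] at h1
      rw [h1]
      push_cast
      ring

/-- If the obstruction vanishes, then the series for the next correction has a sum. -/
theorem exists_isCorrectionSeries {Δ : ℝ} {v u : V} {U : ℕ → ℝ → V →ₗ[ℂ] T.Hat}
    {f : ℕ → T.Hat} {h n : ℕ} (hu : u ∈ T.gr (Δ, Δ)) (hn : n + 1 ≤ h)
    (hU : ∀ k ≤ h, ∀ r ∈ Set.Ioo (0 : ℝ) 1, ∀ κ, ∀ y ∈ T.gr κ,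
      T.IsTimeOrderedSeries v k r κ y (U k r y))
    (hU0 : ∀ r ∈ Set.Ioo (0 : ℝ) 1, ∀ κ, ∀ v ∈ T.gr κ,
      (U 0 r v κ : V) = ((r ^ (κ.1 + κ.2) : ℝ) : ℂ) • v ∧ ∀ ω, ω ≠ κ → U 0 r v ω = 0)
    (hc : T.ModeSeriesConverge v u h)
    (hf : ∀ k < n + 1, T.IsFullSeries Δ v u k (f k))
    (hobs : ∀ k, 1 ≤ k → k < n + 1 → T.ObstructionVanishes v u k) :
    ∃ x, T.IsCorrectionSeries Δ v u (n + 1) x := by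
  have hr : (1 / 2 : ℝ) ∈ Set.Ioo (0 : ℝ) 1 := by norm_num
  obtain ⟨Y, hYs, -, hM, -⟩ := exists_lowerContribution hu hn hU hU0 hc hf hobs hr
  -- Solves the equation at r = 1/2 for the unknown. In weight (Δ,Δ) the first factor is the inverse
  -- of 0, hence 0, and that component is free anyway.
  refine ⟨fun ω => (((1 - (1 / 2 : ℝ) ^ (2 * (ω.1 - Δ)) : ℝ) : ℂ)⁻¹ *
    (((1 / 2 : ℝ) ^ (2 * Δ) : ℝ) : ℂ)⁻¹) • Y ω, ?_⟩
  rw [isCorrectionSeries_iff]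
  refine ⟨fun ω hω => ?_, fun M hM0 φ => ?_⟩
  · simp only [hYs ω hω, smul_zero]
  · refine (hasSum_mul_left_cancel (one_sub_rpow_ne_zero hr hM0) (hM M hM0 φ)).of_eq
      (fun _ => rfl) ?_
    simp only [add_sub_cancel_left, Submodule.coe_smul, map_smul, smul_eq_mul, mul_assoc]

/-- The last partial sum is the total sum, so no term of the series has total zero: the full series
has no component of weight (Δ,Δ). -/
theorem IsCorrectionSeries.isFullSeries {Δ : ℝ} {v u : V} {n : ℕ} {x : T.Hat}
    (hx : T.IsCorrectionSeries Δ v u (n + 1) x) (h0 : x (Δ, Δ) = 0) :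
    T.IsFullSeries Δ v u (n + 1) x := by
  rw [isCorrectionSeries_iff] at hx
  refine ⟨hx.1, fun M φ => ?_⟩
  by_cases hM : M = 0
  · subst hM
    rw [add_zero, h0]
    refine hasSum_zero.of_eq (fun m => ?_) (by simp)
    rw [correctionTerm, if_neg]
    exact fun hm => sum_ne_zero_of_partialSum_ne_zero hm.1 hm.2
  · exact hx.2 M hM φ

theorem IsDeformation.isFullSeries_zero {Δ : ℝ} {Θ : Module.End ℂ V} {v u : V} {h : ℕ}
    {U : ℕ → ℝ → V →ₗ[ℂ] T.Hat} {f : ℕ → T.Hat} (D : T.IsDeformation Δ Θ u h U f) :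
    T.IsFullSeries Δ v u 0 (f 0) := by
  refine ⟨fun w hw => D.field_zero.2 w ?_, fun M φ => ?_⟩
  · rintro rfl
    exact hw rfl
  · refine (hasSum_unique _).of_eq (fun _ => rfl) ?_
    by_cases hM : M = 0
    · subst hM
      rw [add_zero, D.field_zero.1]
      simp [correctionTerm, modeProd]
    · rw [D.field_zero.2 _ (by simpa using hM), correctionTerm, if_neg]
      · simp
      · simpa using Ne.symm hM

/-- Induction over the given corrections: each solves its equation, so its obstruction vanishes and
it is the series up to weight (Δ,Δ). The weight hypothesis excludes that remaining freedom. -/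
theorem IsDeformation.isFullSeries {Δ : ℝ} {Θ : Module.End ℂ V} {u : V} {h : ℕ}
    {U : ℕ → ℝ → V →ₗ[ℂ] T.Hat} {f : ℕ → T.Hat} (D : T.IsDeformation Δ Θ u h U f)
    (hu : u ∈ T.gr (Δ, Δ)) (hv : Θ u ∈ T.gr (1, 1))
    (hf : ∀ k, 1 ≤ k → k < h → T.HasWeightGT Δ (f k))
    (hc : T.ModeSeriesConverge (Θ u) u h) (k : ℕ) (hk : k < h) :
    T.IsFullSeries Δ (Θ u) u k (f k) ∧ (1 ≤ k → T.ObstructionVanishes (Θ u) u k) := by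
  induction k using Nat.strong_induction_on with
  | _ k ih =>
  cases k with
  | zero => exact ⟨D.isFullSeries_zero, fun h => absurd h (by omega)⟩
  | succ n =>
    have h1 := (isAnnulusPrimaryAt_iff hu hk.le (D.isTimeOrderedSeries hv hf hc) D.annulus_zero hc
      (fun k hk' => (ih k hk' (hk'.trans hk)).1)
      (fun k hk1 hk' => (ih k hk' (hk'.trans hk)).2 hk1)).1 ⟨D.spinless _ hk, D.primary _ hk⟩
    refine ⟨h1.2.isFullSeries ?_, fun _ => h1.1⟩
    by_contra h0
    exact lt_irrefl _ (hf (n + 1) (by omega) hk _ h0).1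

/-- The theorem on deformations along a field `u` of weight `(Δ, Δ)` for which `Θ u` has weight
`(1, 1)`. -/
theorem IsDeformation.series_and_corrections {Δ : ℝ} {Θ : Module.End ℂ V} {u : V} {h : ℕ} (hh : 1 ≤ h)
    {U : ℕ → ℝ → V →ₗ[ℂ] T.Hat} {f : ℕ → T.Hat} (D : T.IsDeformation Δ Θ u h U f)
    (hu : u ∈ T.gr (Δ, Δ)) (hv : Θ u ∈ T.gr (1, 1))
    (hf : ∀ k, 1 ≤ k → k < h → T.HasWeightGT Δ (f k))
    (hc : T.ModeSeriesConverge (Θ u) u h) :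
    (∀ r ∈ Set.Ioo (0 : ℝ) 1, ∀ κ, ∀ y ∈ T.gr κ,
      T.IsTimeOrderedSeries (Θ u) h r κ y (U h r y)) ∧
    (∀ x : T.Hat, T.IsNextCorrection Δ h U f x ↔
      T.ObstructionVanishes (Θ u) u h ∧ T.IsCorrectionSeries Δ (Θ u) u h x) ∧
    ((∃ x : T.Hat, T.IsNextCorrection Δ h U f x) ↔ T.ObstructionVanishes (Θ u) u h) := by
  obtain ⟨n, rfl⟩ : ∃ n, h = n + 1 := ⟨h - 1, by omega⟩
  have hser := D.isTimeOrderedSeries hv hf hc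
  have hfull := D.isFullSeries hu hv hf hc
  have hb : ∀ x : T.Hat, T.IsNextCorrection Δ (n + 1) U f x ↔
      T.ObstructionVanishes (Θ u) u (n + 1) ∧ T.IsCorrectionSeries Δ (Θ u) u (n + 1) x := by
    intro x
    have h1 := isAnnulusPrimaryAt_iff (f := Function.update f (n + 1) x) hu le_rfl hser
      D.annulus_zero hc (fun k hk => by
        rw [Function.update_of_ne hk.ne]
        exact (hfull k hk).1) (fun k hk1 hk => (hfull k hk).2 hk1)
    rwa [Function.update_self] at h1
  refine ⟨hser (n + 1) le_rfl, hb, fun ⟨x, hx⟩ => ((hb x).1 hx).1, fun ho => ?_⟩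
  obtain ⟨x, hx⟩ := exists_isCorrectionSeries hu le_rfl hser D.annulus_zero hc
    (fun k hk => (hfull k hk).1) (fun k hk1 hk => (hfull k hk).2 hk1)
  exact ⟨x, (hb x).2 ⟨ho, hx⟩⟩

/-- The commutator of L_0 with G_{-1/2} is G_{-1/2}/2, so each supercurrent mode raises the weight
of its own chirality by 1/2 and leaves the other one unchanged. -/
theorem supercurrent_pair_mem {G Gt : ℤ → Module.End ℂ V} (hG : IsSupercurrent T.L G)
    (hGt : IsSupercurrent T.Lt Gt) (hl : T.Lt 0 * G (-1) = G (-1) * T.Lt 0)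
    (hr : T.L 0 * Gt (-1) = Gt (-1) * T.L 0) {u : V} (hu : u ∈ T.gr (1 / 2, 1 / 2)) :
    G (-1) (Gt (-1) u) ∈ T.gr (1, 1) := by
  obtain ⟨h1, h2⟩ := (T.mem_gr _ _).1 hu
  have e1 := fun w => LinearMap.congr_fun (hG 0 (-1)) w
  have e2 := fun w => LinearMap.congr_fun (hGt 0 (-1)) w
  have e3 := fun w => LinearMap.congr_fun hl w
  have e4 := fun w => LinearMap.congr_fun hr w
  simp only [LinearMap.sub_apply, LinearMap.smul_apply, Module.End.mul_apply, zero_add,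
    sub_eq_iff_eq_add] at e1 e2 e3 e4
  rw [T.mem_gr]
  constructor
  · rw [e1, e4, h1]
    simp only [map_smul, ← add_smul]
    congr 1
    norm_num
  · rw [e3, e2, h2]
    simp only [map_smul, ← add_smul]
    congr 1
    norm_num

end ConformalFieldTheory

end

theorem mainTheorem2 {V : Type*} [AddCommGroup V] [Module ℂ V] (T : ConformalFieldTheory V)
    (h : ℕ) (hh : 1 ≤ h) (U : ℕ → ℝ → V →ₗ[ℂ] T.Hat) (f : ℕ → T.Hat) (u : V) :
    -- the non-supersymmetric case
    (T.IsPrimary u →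
      T.IsDeformation 1 1 u h U f →
      (∀ k, 1 ≤ k → k < h → T.HasWeightGT 1 (f k)) →
      T.ModeSeriesConverge u u h →
        (∀ r ∈ Set.Ioo (0 : ℝ) 1, ∀ κ, ∀ y ∈ T.gr κ,
          T.IsTimeOrderedSeries u h r κ y (U h r y)) ∧
        (∀ x : T.Hat, T.IsNextCorrection 1 h U f x ↔
          T.ObstructionVanishes u u h ∧ T.IsCorrectionSeries 1 u u h x) ∧
        ((∃ x : T.Hat, T.IsNextCorrection 1 h U f x) ↔ T.ObstructionVanishes u u h)) ∧
    -- the case of N = 1 supersymmetry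
    (∀ S : T.N1Supersymmetry, S.IsPrimary u →
      T.IsDeformation (1 / 2) (S.G (-1) * S.Gt (-1)) u h U f →
      (∀ k, 1 ≤ k → k < h → T.HasWeightGT (1 / 2) (f k)) →
      T.ModeSeriesConverge (S.G (-1) (S.Gt (-1) u)) u h →
        (∀ r ∈ Set.Ioo (0 : ℝ) 1, ∀ κ, ∀ y ∈ T.gr κ,
          T.IsTimeOrderedSeries (S.G (-1) (S.Gt (-1) u)) h r κ y (U h r y)) ∧
        (∀ x : T.Hat, T.IsNextCorrection (1 / 2) h U f x ↔
          T.ObstructionVanishes (S.G (-1) (S.Gt (-1) u)) u h ∧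
          T.IsCorrectionSeries (1 / 2) (S.G (-1) (S.Gt (-1) u)) u h x) ∧
        ((∃ x : T.Hat, T.IsNextCorrection (1 / 2) h U f x) ↔
          T.ObstructionVanishes (S.G (-1) (S.Gt (-1) u)) u h)) ∧
    -- the case of N = 2 supersymmetry and a cc field
    (∀ S : T.N2Supersymmetry, S.IsCC u →
      T.IsDeformation (1 / 2) (S.Gm (-1) * S.Gmt (-1)) u h U f →
      (∀ k, 1 ≤ k → k < h → T.HasWeightGT (1 / 2) (f k)) →
      T.ModeSeriesConverge (S.Gm (-1) (S.Gmt (-1) u)) u h →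
        (∀ r ∈ Set.Ioo (0 : ℝ) 1, ∀ κ, ∀ y ∈ T.gr κ,
          T.IsTimeOrderedSeries (S.Gm (-1) (S.Gmt (-1) u)) h r κ y (U h r y)) ∧
        (∀ x : T.Hat, T.IsNextCorrection (1 / 2) h U f x ↔
          T.ObstructionVanishes (S.Gm (-1) (S.Gmt (-1) u)) u h ∧
          T.IsCorrectionSeries (1 / 2) (S.Gm (-1) (S.Gmt (-1) u)) u h x) ∧
        ((∃ x : T.Hat, T.IsNextCorrection (1 / 2) h U f x) ↔
          T.ObstructionVanishes (S.Gm (-1) (S.Gmt (-1) u)) u h)) := by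
  refine ⟨fun hp D hf hc => ?_, fun S hp D hf hc => ?_, fun S hp D hf hc => ?_⟩
  -- With Θ = 1 and Δ = 1, the weight of `u` and that of Θu are the same condition.
  · exact D.series_and_corrections hh hp.1 hp.1 hf hc
  · exact D.series_and_corrections hh hp.1 (ConformalFieldTheory.supercurrent_pair_mem S.left.2.1 S.right.2.1
      (S.comm_left 0 (-1)) (S.comm_right 0 (-1)) hp.1) hf hc
  · exact D.series_and_corrections hh hp.1 (ConformalFieldTheory.supercurrent_pair_mem S.left.2.2.1 S.right.2.2.1
      (S.comm_left 0 (-1)).2.2.1 (S.comm_right 0 (-1)).2.2.1 hp.1) hf hc
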